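/- Let $d\ge 1$ and $N\ge 2$ be integers and let $s>0$ be real. For $u\in L^2(\mathbb R^{dN})$ (complex valued) set $$\|u\|_{H^s}^2:=\int_{\mathbb R^{dN}}|u(x)|^2\,dx+\int_{\mathbb R^{dN}}|p|^{2s}\,|\widehat u(p)|^2\,dp ,$$ where $\widehat u(p)=(2\pi)^{-dN/2}\int_{\mathbb R^{dN}} u(x)e^{-ip\cdot x}\,dx$ (extended to $L^2$), and let $H^s(\mathbb R^{dN})$ be the space of those $u\in L^2(\mathbb R^{dN})$ with $\|u\|_{H^s}<\infty$. Write $x=(\mathbf x_1,\dots,\mathbf x_N)\in(\mathbb R^d)^N=\mathbb R^{dN}$ and let $$\Delta:=\{x\in\mathbb R^{dN}:\ \mathbf x_i=\mathbf x_j\text{ for some } i\ne j\},\qquad W_s(x):=\sum_{1\le i<j\le N}|\mathbf x_i-\mathbf x_j|^{-2s}.$$ Define the form domain of the pair interaction and the hard-core space by $$\mathcal H^{s,N}_W(\mathbb R^d):=\Bigl\{\Psi\in H^s(\mathbb R^{dN}):\ \int_{\mathbb R^{dN}}W_s|\Psi|^2<\infty\Bigr\},\qquad \mathcal H^{s,N}_0(\mathbb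 R^d):=\overline{C_c^\infty(\mathbb R^{dN}\setminus\Delta)}^{\,H^s(\mathbb R^{dN})}.$$ Then $\mathcal H^{s,N}_W(\mathbb R^d)\subseteq\mathcal H^{s,N}_0(\mathbb R^d)$. -/

import Mathlib

open MeasureTheory FourierTransform
open scoped ENNReal ContDiff

noncomputable section

namespace ContactInteraction

/-- The `N`-particle configuration space `ℝ^{dN} = (ℝ^d)^N`, with its Euclidean norm and
Lebesgue measure. The coordinate `(i, a)` is the `a`-th coordinate of the `i`-th particle. -/
abbrev Config (d N : ℕ) : Type := EuclideanSpace ℝ (Fin N × Fin d)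

/-- The Hilbert space `L²(ℝ^{dN}; ℂ)`. -/
abbrev L2 (d N : ℕ) : Type := Lp ℂ 2 (volume : Measure (Config d N))

/-- The position `𝐱_i ∈ ℝ^d` of the `i`-th particle in the configuration `x`. -/
def position {d N : ℕ} (x : Config d N) (i : Fin N) : EuclideanSpace ℝ (Fin d) :=
  WithLp.toLp 2 (fun a => x (i, a))

/-- The diagonal set: configurations in which two distinct particles have the same position. -/
def diagonal (d N : ℕ) : Set (Config d N) :=
  {x | ∃ i j : Fin N, i ≠ j ∧ position x i = position x j}

/-- The singular pair interaction `W_s(x) = ∑_{i < j} |𝐱_i - 𝐱_j|^{-2s}`, with values in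
`[0, ∞]` (for `s > 0` it is `∞` exactly on the diagonal). -/
def pairInteraction {d N : ℕ} (s : ℝ) (x : Config d N) : ℝ≥0∞ :=
  ∑ i : Fin N, ∑ j ∈ Finset.Ioi i, edist (position x i) (position x j) ^ (-(2 * s))

/-- The squared Sobolev norm `‖u‖²_{H^s} = ‖u‖²_{L²} + ⟨u, (-Δ)^s u⟩ ∈ [0, ∞]`, where `(-Δ)^s` is
multiplication by `|p|^{2s}` in Fourier space. Mathlib's Fourier transform (here the unitary one on
`L²`) has kernel `e^{-2πi ⟨ξ, x⟩}`, so that `p = 2πξ`. -/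
def sobolevNormSq {d N : ℕ} (s : ℝ) (u : L2 d N) : ℝ≥0∞ :=
  (∫⁻ x, ‖u x‖ₑ ^ 2) +
    ∫⁻ ξ, ENNReal.ofReal ((2 * Real.pi * ‖ξ‖) ^ (2 * s)) * ‖(𝓕 u : L2 d N) ξ‖ₑ ^ 2

/-- The Sobolev space `H^s(ℝ^{dN})`, as a set of `L²` functions. -/
def sobolevSpace (d N : ℕ) (s : ℝ) : Set (L2 d N) :=
  {u | sobolevNormSq s u < ⊤}

/-- The form domain of the pair interaction:
functions `Ψ ∈ H^s(ℝ^{dN})` with `∫ W_s |Ψ|² < ∞`. -/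
def interactionFormDomain (d N : ℕ) (s : ℝ) : Set (L2 d N) :=
  {Ψ | Ψ ∈ sobolevSpace d N s ∧ ∫⁻ x, pairInteraction s x * ‖Ψ x‖ₑ ^ 2 < ⊤}

/-- The (classes of) functions in `C_c^∞(ℝ^{dN} ∖ diagonal)`: smooth complex functions whose
support is compact and does not meet the diagonal. -/
def testFunctionsOffDiagonal (d N : ℕ) : Set (L2 d N) :=
  {v | ∃ φ : Config d N → ℂ, ContDiff ℝ ∞ φ ∧ HasCompactSupport φ ∧
    tsupport φ ⊆ (diagonal d N)ᶜ ∧ v =ᵐ[volume] φ}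

/-- The hard-core space: the closure of `C_c^∞(ℝ^{dN} ∖ diagonal)` in `H^s(ℝ^{dN})`. -/
def hardCoreSpace (d N : ℕ) (s : ℝ) : Set (L2 d N) :=
  {Ψ | Ψ ∈ sobolevSpace d N s ∧
    ∀ ε : ℝ≥0∞, 0 < ε → ∃ v ∈ testFunctionsOffDiagonal d N, sobolevNormSq s (Ψ - v) < ε}

end ContactInteraction

end

/-! Each pair gives a linear map `ℓ x = 𝐱_i - 𝐱_j`, and the diagonal is the union of the kernels. It
suffices to remove from `u` its part near one kernel at small cost in `H^s`, pair by pair, and then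
to regularize away from the kernels.

The part removed is `κ(nℓx) γ(nℓx) u`, where `κγ = 1` near the origin, `κ` has compact support and
`𝓕 γ` has compact support. No cutoff is compactly supported in both position and frequency; the
factorization gives one property to each factor. Since `𝓕 γ` is supported in a ball of radius `ρ`,
multiplication by `γ(nℓ·)` shifts frequencies by at most `n‖ℓ‖ρ`. Output above `cn`, with `c = 1 +
‖ℓ‖ρ`, therefore comes from frequencies of `u` above `n`, a tail that vanishes because `u ∈ H^s`.
Below `cn` the weight is at most a constant times `n^{2s}`, and `n^{2s}‖γ(nℓ·)u‖²` tends to zero by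
dominated convergence with majorant `C|ℓ|^{-2s}|u|²`. The factor `κ(nℓ·)` is harmless: it is bounded
uniformly in `n` for the weight `(n+|ξ|)^{2s}`. This works for every `s > 0`, without Hardy or
fractional Leibniz inequalities; see `exists_fourierNormSq_mulL2_le` and
`tendsto_fourierNormSq_mulL2`.

Once `v` vanishes near the kernels, Schwartz approximants of `v` are multiplied by `1 - κγ` at a
fixed scale at which this does not change `v` (`exists_schwartz_vanishing_near_ker`), and a cutoff
at infinity makes the support compact. -/

namespace ContactInteraction

set_option linter.unusedSectionVars false

/-! ### Weighted Fourier bounds for multiplication operators -/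

section Multiplier

open SchwartzMap

variable {E Q : Type*} [NormedAddCommGroup E] [InnerProductSpace ℝ E] [FiniteDimensional ℝ E]
  [MeasurableSpace E] [BorelSpace E]
  [NormedAddCommGroup Q] [InnerProductSpace ℝ Q] [FiniteDimensional ℝ Q]
  [MeasurableSpace Q] [BorelSpace Q]

/-- The Fourier transform of a product with a function of a linear image of the variable is a
superposition of translates of the Fourier transform. -/
theorem fourier_smul_comp_apply (η : 𝓢(Q, ℂ)) (ℓ : E →L[ℝ] Q) (φ : 𝓢(E, ℂ)) (ξ : E) :
    𝓕 (fun x => η (ℓ x) * φ x) ξ = ∫ q, 𝓕 η q * 𝓕 φ (ξ - ℓ.adjoint q) := by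
  have hη : ∀ y : Q, η y = ∫ q, Real.fourierChar (inner ℝ q y) • 𝓕 η q := by
    intro y
    conv_lhs => rw [← FourierTransform.fourierInv_fourier_eq (E := 𝓢(Q, ℂ)) (F := 𝓢(Q, ℂ)) η]
    rw [fourierInv_coe, Real.fourierInv_eq]
  -- After Fourier inversion of `η`, the character in `ℓ x` is absorbed into the frequency through
  -- the adjoint.
  have key : ∀ (x : E) (q : Q), Real.fourierChar (-inner ℝ x ξ) •
      ((Real.fourierChar (inner ℝ q (ℓ x)) • 𝓕 η q) * φ x) =
      𝓕 η q * (Real.fourierChar (-inner ℝ x (ξ - ℓ.adjoint q)) • φ x) := by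
    intro x q
    have h : -inner ℝ x (ξ - ℓ.adjoint q) = -inner ℝ x ξ + inner ℝ q (ℓ x) := by
      rw [inner_sub_right, ContinuousLinearMap.adjoint_inner_right, real_inner_comm q]; ring
    rw [h, AddChar.map_add_eq_mul]
    simp only [Circle.smul_def, Circle.coe_mul, smul_eq_mul]
    ring
  rw [Real.fourier_eq]
  calc ∫ x, Real.fourierChar (-inner ℝ x ξ) • (η (ℓ x) * φ x)
      = ∫ x, ∫ q, 𝓕 η q * (Real.fourierChar (-inner ℝ x (ξ - ℓ.adjoint q)) • φ x) := by
        refine integral_congr_ae (.of_forall fun x => ?_)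
        simp only [← key]
        rw [Circle.smul_def, smul_eq_mul]
        simp only [Circle.smul_def (Real.fourierChar (-inner ℝ x ξ)), smul_eq_mul]
        rw [integral_const_mul, integral_mul_const, ← hη]
    _ = ∫ q, ∫ x, 𝓕 η q * (Real.fourierChar (-inner ℝ x (ξ - ℓ.adjoint q)) • φ x) := by
        refine integral_integral_swap ?_
        have h := (φ.integrable (μ := volume)).mul_prod ((𝓕 η).integrable (μ := volume))
        refine h.mono (Continuous.aestronglyMeasurable ?_) (.of_forall fun p => ?_)
        · have := (𝓕 η).continuous
          have := φ.continuous
          have := Real.continuous_fourierChar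
          simp only [Function.uncurry_def, Circle.smul_def]
          fun_prop
        · simp [Function.uncurry_def, mul_comm]
    _ = _ := by
        refine integral_congr_ae (.of_forall fun q => ?_)
        simp only
        rw [integral_const_mul, fourier_coe φ, Real.fourier_eq]

/-- Cauchy–Schwarz for the measure with density `f`, from the splitting `f g = f^{1/2} · (f^{1/2}
g)`. -/
theorem sq_lintegral_mul_le {α : Type*} [MeasurableSpace α] (μ : Measure α) {f g : α → ℝ≥0∞}
    (hf : AEMeasurable f μ) (hg : AEMeasurable g μ) :
    (∫⁻ x, f x * g x ∂μ) ^ 2 ≤ (∫⁻ x, f x ∂μ) * ∫⁻ x, f x * g x ^ 2 ∂μ := by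
  have h := ENNReal.lintegral_mul_le_Lp_mul_Lq μ (p := 2) (q := 2)
    Real.HolderConjugate.two_two (f := fun x => f x ^ (2⁻¹ : ℝ))
    (g := fun x => f x ^ (2⁻¹ : ℝ) * g x) (hf.pow_const _) ((hf.pow_const _).mul hg)
  have e : ∀ a : ℝ≥0∞, (a ^ (2⁻¹ : ℝ)) ^ (2 : ℝ) = a := fun a => by
    rw [← ENNReal.rpow_mul]; norm_num
  have e' : ∀ a : ℝ≥0∞, a ^ (2⁻¹ : ℝ) * a ^ (2⁻¹ : ℝ) = a := fun a => by
    conv_rhs => rw [← e a, ENNReal.rpow_two, sq]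
  simp only [Pi.mul_apply, ← mul_assoc, e', e, ENNReal.mul_rpow_of_nonneg _ _ zero_le_two] at h
  calc (∫⁻ x, f x * g x ∂μ) ^ 2
      ≤ ((∫⁻ x, f x ∂μ) ^ (1 / 2 : ℝ) * (∫⁻ x, f x * g x ^ (2 : ℝ) ∂μ) ^ (1 / 2 : ℝ)) ^ 2 := by
        gcongr
    _ = _ := by
        rw [mul_pow, one_div, ← ENNReal.rpow_two, ← ENNReal.rpow_two, e, e]
        simp

/-- Weighted `L²` bound in Fourier space for a product with a function of a linear image of the
variable, for Schwartz functions. -/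
theorem lintegral_fourier_smul_comp_le_schwartz (η : 𝓢(Q, ℂ)) (ℓ : E →L[ℝ] Q) (φ : 𝓢(E, ℂ))
    {w₁ w₂ : E → ℝ≥0∞} {K : Q → ℝ≥0∞} (hw₁ : Measurable w₁) (hw₂ : Measurable w₂)
    (hK : Measurable K)
    (h : ∀ q ξ, 𝓕 η q ≠ 0 → w₁ (ξ + ℓ.adjoint q) ≤ K q * w₂ ξ) :
    ∫⁻ ξ, w₁ ξ * ‖𝓕 (fun x => η (ℓ x) * φ x) ξ‖ₑ ^ 2 ≤
      (∫⁻ q, ‖𝓕 η q‖ₑ) * (∫⁻ q, ‖𝓕 η q‖ₑ * K q) * ∫⁻ ξ, w₂ ξ * ‖𝓕 φ ξ‖ₑ ^ 2 := by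
  have cη := (𝓕 η).continuous
  have cφ := (𝓕 φ).continuous
  have hpt : ∀ ξ, ‖𝓕 (fun x => η (ℓ x) * φ x) ξ‖ₑ ^ 2 ≤
      (∫⁻ q, ‖𝓕 η q‖ₑ) * ∫⁻ q, ‖𝓕 η q‖ₑ * ‖𝓕 φ (ξ - ℓ.adjoint q)‖ₑ ^ 2 := by
    intro ξ
    rw [fourier_smul_comp_apply]
    calc _ ≤ (∫⁻ q, ‖𝓕 η q‖ₑ * ‖𝓕 φ (ξ - ℓ.adjoint q)‖ₑ) ^ 2 := by
          gcongr
          refine (enorm_integral_le_lintegral_enorm _).trans_eq ?_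
          simp only [enorm_mul]
      _ ≤ _ := sq_lintegral_mul_le _ (by fun_prop) (by fun_prop)
  calc _ ≤ ∫⁻ ξ, (∫⁻ q, ‖𝓕 η q‖ₑ) *
        ∫⁻ q, w₁ ξ * (‖𝓕 η q‖ₑ * ‖𝓕 φ (ξ - ℓ.adjoint q)‖ₑ ^ 2) := by
        refine lintegral_mono fun ξ => ?_
        rw [lintegral_const_mul _ (by fun_prop), mul_left_comm]
        exact mul_le_mul_right (hpt ξ) _
    _ = (∫⁻ q, ‖𝓕 η q‖ₑ) *
        ∫⁻ q, ∫⁻ ξ, w₁ ξ * (‖𝓕 η q‖ₑ * ‖𝓕 φ (ξ - ℓ.adjoint q)‖ₑ ^ 2) := by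
        rw [lintegral_const_mul' _ _ (by
          simpa [hasFiniteIntegral_iff_enorm] using (𝓕 η).integrable.hasFiniteIntegral.ne)]
        rw [lintegral_lintegral_swap]
        exact ((hw₁.comp measurable_fst).mul (by fun_prop)).aemeasurable
    _ ≤ (∫⁻ q, ‖𝓕 η q‖ₑ) * ∫⁻ q, (‖𝓕 η q‖ₑ * K q) * ∫⁻ ξ, w₂ ξ * ‖𝓕 φ ξ‖ₑ ^ 2 := by
        gcongr with q
        -- Translation invariance moves the shift from `𝓕 φ` onto the weight. Frequencies `q`
        -- outside the support of `𝓕 η` contribute nothing, so `h` is needed only on it.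
        rw [← lintegral_add_right_eq_self _ (ℓ.adjoint q),
          ← lintegral_const_mul _ (by fun_prop)]
        refine lintegral_mono fun ξ => ?_
        simp only [add_sub_cancel_right]
        by_cases hq : 𝓕 η q = 0
        · simp [hq]
        · calc _ ≤ (K q * w₂ ξ) * (‖𝓕 η q‖ₑ * ‖𝓕 φ ξ‖ₑ ^ 2) := by gcongr; exact h q ξ hq
            _ = _ := by ring
    _ ≤ _ := by
        rw [mul_assoc, lintegral_mul_const _ (by fun_prop)]

/-- Multiplication by a bounded continuous function, on `L²`. -/
noncomputable def mulL2 (m : BoundedContinuousFunction E ℂ) :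
    Lp ℂ 2 (volume : Measure E) →L[ℂ] Lp ℂ 2 (volume : Measure E) :=
  (ContinuousLinearMap.mul ℂ ℂ).holderL volume ⊤ 2 2
    (memLp_top_of_bound m.continuous.aestronglyMeasurable ‖m‖
      (.of_forall m.norm_coe_le_norm)).toLp

theorem coeFn_mulL2 (m : BoundedContinuousFunction E ℂ) (u : Lp ℂ 2 (volume : Measure E)) :
    mulL2 m u =ᵐ[volume] fun x => m x * u x := by
  have hm := memLp_top_of_bound (μ := (volume : Measure E)) m.continuous.aestronglyMeasurable ‖m‖
      (.of_forall m.norm_coe_le_norm)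
  filter_upwards [(ContinuousLinearMap.mul ℂ ℂ).coeFn_holder (r := 2) hm.toLp u, hm.coeFn_toLp]
    with x h₁ h₂
  rw [← h₂]
  exact h₁

/-- The pullback of a Schwartz function by a continuous linear map. -/
noncomputable def pullback (η : 𝓢(Q, ℂ)) (ℓ : E →L[ℝ] Q) : BoundedContinuousFunction E ℂ :=
  η.toBoundedContinuousFunction.compContinuous ⟨ℓ, ℓ.continuous⟩

@[simp]
theorem pullback_apply (η : 𝓢(Q, ℂ)) (ℓ : E →L[ℝ] Q) (x : E) : pullback η ℓ x = η (ℓ x) := rfl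

theorem mulL2_toLp (η : 𝓢(Q, ℂ)) (ℓ : E →L[ℝ] Q) (φ : 𝓢(E, ℂ)) :
    mulL2 (pullback η ℓ) (φ.toLp 2) = (smulLeftCLM ℂ (fun x => η (ℓ x)) φ).toLp 2 := by
  have hη : (fun x => η (ℓ x)).HasTemperateGrowth :=
    η.hasTemperateGrowth.comp ℓ.hasTemperateGrowth
  refine Lp.ext ?_
  filter_upwards [coeFn_mulL2 (pullback η ℓ) (φ.toLp 2), φ.coeFn_toLp 2 volume,
    (smulLeftCLM ℂ (fun x => η (ℓ x)) φ).coeFn_toLp 2 volume] with x h₁ h₂ h₃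
  rw [h₁, h₂, h₃, smulLeftCLM_apply_apply hη, pullback_apply, smul_eq_mul]

theorem eLpNorm_two_withDensity_sq {w : E → ℝ≥0∞} (hw : Measurable w) {f : E → ℂ}
    (hf : AEStronglyMeasurable f volume) :
    eLpNorm f 2 (volume.withDensity w) ^ 2 = ∫⁻ ξ, w ξ * ‖f ξ‖ₑ ^ 2 := by
  rw [eLpNorm_eq_lintegral_rpow_enorm_toReal two_ne_zero ENNReal.ofNat_ne_top, ← ENNReal.rpow_two,
    ← ENNReal.rpow_mul]
  simp only [ENNReal.toReal_ofNat, one_div, ENNReal.rpow_two]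
  rw [inv_mul_cancel₀ two_ne_zero, ENNReal.rpow_one,
    lintegral_withDensity_eq_lintegral_mul₀ hw.aemeasurable (by fun_prop)]
  rfl

/-- For a weight bounded by `R` the weighted seminorm is `√R`-Lipschitz on `L²`. This is what makes
density arguments available after truncation of an unbounded weight. -/
theorem continuous_lintegral_mul_enorm_sq {w : E → ℝ≥0∞} (hw : Measurable w) {R : ℝ≥0∞}
    (hR : R ≠ ⊤) (hwR : ∀ ξ, w ξ ≤ R) :
    Continuous fun f : Lp ℂ 2 (volume : Measure E) => ∫⁻ ξ, w ξ * ‖f ξ‖ₑ ^ 2 := by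
  have hle : volume.withDensity w ≤ R • (volume : Measure E) := by
    rw [← withDensity_const]
    exact withDensity_mono (.of_forall hwR)
  have hac := withDensity_absolutelyContinuous (volume : Measure E) w
  have hcont : Continuous fun f : Lp ℂ 2 (volume : Measure E) =>
      eLpNorm f 2 (volume.withDensity w) := by
    refine continuous_of_le_add_edist (R ^ (1 / 2 : ℝ≥0∞).toReal) (by finiteness) fun f g => ?_
    have hf := (Lp.aestronglyMeasurable f).mono_ac hac
    have hg := (Lp.aestronglyMeasurable g).mono_ac hac
    calc eLpNorm f 2 (volume.withDensity w)
        = eLpNorm (⇑g + (⇑f - ⇑g)) 2 (volume.withDensity w) := by rw [add_sub_cancel]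
      _ ≤ eLpNorm g 2 (volume.withDensity w) + eLpNorm (⇑f - ⇑g) 2 (volume.withDensity w) :=
          eLpNorm_add_le hg (hf.sub hg) one_le_two
      _ ≤ _ := by
          gcongr
          refine (eLpNorm_mono_measure _ hle).trans_eq ?_
          rw [eLpNorm_smul_measure_of_ne_top ENNReal.ofNat_ne_top, Lp.edist_def, smul_eq_mul]
  have h2 := (ENNReal.continuous_pow 2).comp hcont
  refine h2.congr fun f => ?_
  exact eLpNorm_two_withDensity_sq hw (Lp.aestronglyMeasurable f)

/-- Weighted `L²` bound in Fourier space for a product with a function of a linear image of the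
variable. -/
theorem lintegral_fourier_mulL2_le (η : 𝓢(Q, ℂ)) (ℓ : E →L[ℝ] Q)
    (u : Lp ℂ 2 (volume : Measure E))
    {w₁ w₂ : E → ℝ≥0∞} {K : Q → ℝ≥0∞} (hw₁ : Measurable w₁) (hw₂ : Measurable w₂)
    (hK : Measurable K) (hK₁ : ∀ q, 1 ≤ K q)
    (hKint : ∫⁻ q, ‖𝓕 η q‖ₑ * K q ≠ ⊤)
    (h : ∀ q ξ, 𝓕 η q ≠ 0 → w₁ (ξ + ℓ.adjoint q) ≤ K q * w₂ ξ) :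
    ∫⁻ ξ, w₁ ξ * ‖(𝓕 (mulL2 (pullback η ℓ) u) : Lp ℂ 2 (volume : Measure E)) ξ‖ₑ ^ 2 ≤
      (∫⁻ q, ‖𝓕 η q‖ₑ) * (∫⁻ q, ‖𝓕 η q‖ₑ * K q) *
        ∫⁻ ξ, w₂ ξ * ‖(𝓕 u : Lp ℂ 2 (volume : Measure E)) ξ‖ₑ ^ 2 := by
  set C := (∫⁻ q, ‖𝓕 η q‖ₑ) * (∫⁻ q, ‖𝓕 η q‖ₑ * K q) with hC
  have hCtop : C ≠ ⊤ := ENNReal.mul_ne_top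
    (by simpa [hasFiniteIntegral_iff_enorm] using (𝓕 η).integrable.hasFiniteIntegral.ne) hKint
  -- With truncated weights both sides are continuous in `u`, so the Schwartz case suffices;
  -- monotone convergence then removes the truncation.
  have hbdd : ∀ n : ℕ,
      ∫⁻ ξ, min (w₁ ξ) n * ‖(𝓕 (mulL2 (pullback η ℓ) u) : Lp ℂ 2 (volume : Measure E)) ξ‖ₑ ^ 2 ≤
      C * ∫⁻ ξ, min (w₂ ξ) n * ‖(𝓕 u : Lp ℂ 2 (volume : Measure E)) ξ‖ₑ ^ 2 := by
    intro n
    have m₁ : Measurable fun ξ => min (w₁ ξ) (n : ℝ≥0∞) := by fun_prop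
    have m₂ : Measurable fun ξ => min (w₂ ξ) (n : ℝ≥0∞) := by fun_prop
    refine DenseRange.induction_on (p := fun u : Lp ℂ 2 (volume : Measure E) =>
      ∫⁻ ξ, min (w₁ ξ) n * ‖(𝓕 (mulL2 (pullback η ℓ) u) : Lp ℂ 2 (volume : Measure E)) ξ‖ₑ ^ 2 ≤
      C * ∫⁻ ξ, min (w₂ ξ) n * ‖(𝓕 u : Lp ℂ 2 (volume : Measure E)) ξ‖ₑ ^ 2)
      (SchwartzMap.denseRange_toLpCLM (E := E) (F := ℂ) (p := 2) (μ := volume)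
        ENNReal.ofNat_ne_top) u ?_ ?_
    · have c₁ := continuous_lintegral_mul_enorm_sq m₁ (ENNReal.natCast_ne_top n)
        fun ξ => min_le_right _ _
      have c₂ := continuous_lintegral_mul_enorm_sq m₂ (ENNReal.natCast_ne_top n)
        fun ξ => min_le_right _ _
      have cF := (Lp.fourierTransformₗᵢ E ℂ).continuous
      exact isClosed_le (c₁.comp (cF.comp (mulL2 (pullback η ℓ)).continuous))
        ((ENNReal.continuous_const_mul hCtop).comp (c₂.comp cF))
    · intro φ
      have hη : (fun x => η (ℓ x)).HasTemperateGrowth :=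
        η.hasTemperateGrowth.comp ℓ.hasTemperateGrowth
      simp only [toLpCLM_apply, mulL2_toLp, toLp_fourier_eq]
      have e₁ := (𝓕 (smulLeftCLM ℂ (fun x => η (ℓ x)) φ)).coeFn_toLp 2 volume
      have e₂ := (𝓕 φ).coeFn_toLp 2 volume
      have e₃ : (smulLeftCLM ℂ (fun x => η (ℓ x)) φ : E → ℂ) = fun x => η (ℓ x) * φ x := by
        ext x; simp [smulLeftCLM_apply_apply hη]
      calc _ = ∫⁻ ξ, min (w₁ ξ) n * ‖𝓕 (fun x => η (ℓ x) * φ x) ξ‖ₑ ^ 2 := by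
            refine lintegral_congr_ae ?_
            filter_upwards [e₁] with ξ h₁
            rw [h₁, fourier_coe, e₃]
        _ ≤ C * ∫⁻ ξ, min (w₂ ξ) n * ‖𝓕 φ ξ‖ₑ ^ 2 := by
            refine lintegral_fourier_smul_comp_le_schwartz η ℓ φ m₁ m₂ hK fun q ξ hq => ?_
            -- Truncation preserves the weight inequality because `n ≤ K q * n`, which is where `1 ≤
            -- K q` enters.
            rw [mul_min]
            exact min_le_min (h q ξ hq) (le_mul_of_one_le_left' (hK₁ q))
        _ = _ := by
            congr 1
            refine lintegral_congr_ae ?_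
            filter_upwards [e₂] with ξ h₂
            rw [h₂]
  have hsup : ∀ a : ℝ≥0∞, ⨆ n : ℕ, min a (n : ℝ≥0∞) = a := fun a => by
    rw [← inf_iSup_eq, ENNReal.iSup_natCast, inf_top_eq]
  calc _ = ∫⁻ ξ, ⨆ n : ℕ, min (w₁ ξ) n *
        ‖(𝓕 (mulL2 (pullback η ℓ) u) : Lp ℂ 2 (volume : Measure E)) ξ‖ₑ ^ 2 := by
        simp only [← ENNReal.iSup_mul, hsup]
    _ = ⨆ n : ℕ, ∫⁻ ξ, min (w₁ ξ) n *
        ‖(𝓕 (mulL2 (pullback η ℓ) u) : Lp ℂ 2 (volume : Measure E)) ξ‖ₑ ^ 2 := by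
        refine lintegral_iSup' (fun n => ?_) (.of_forall fun ξ i j hij => ?_)
        · have := (Lp.aestronglyMeasurable
            (𝓕 (mulL2 (pullback η ℓ) u) : Lp ℂ 2 (volume : Measure E))).enorm
          fun_prop
        · dsimp only
          gcongr
    _ ≤ _ := by
        refine iSup_le fun n => (hbdd n).trans ?_
        gcongr
        exact min_le_left _ _

end Multiplier

/-! ### Sobolev weights and the factorized cutoff -/

section FourierNorm

open SchwartzMap Filter Topology

variable {E Q : Type*} [NormedAddCommGroup E] [InnerProductSpace ℝ E] [FiniteDimensional ℝ E]
  [MeasurableSpace E] [BorelSpace E]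
  [NormedAddCommGroup Q] [InnerProductSpace ℝ Q] [FiniteDimensional ℝ Q]
  [MeasurableSpace Q] [BorelSpace Q]

/-- The squared `L²` norm in Fourier space with weight `w`. -/
noncomputable def fourierNormSq (w : E → ℝ≥0∞) (u : Lp ℂ 2 (volume : Measure E)) : ℝ≥0∞ :=
  ∫⁻ ξ, w ξ * ‖(𝓕 u : Lp ℂ 2 (volume : Measure E)) ξ‖ₑ ^ 2

theorem enorm_add_sq_le (a b : ℂ) : ‖a + b‖ₑ ^ 2 ≤ 2 * (‖a‖ₑ ^ 2 + ‖b‖ₑ ^ 2) := by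
  have h : ‖a + b‖ ^ 2 ≤ 2 * (‖a‖ ^ 2 + ‖b‖ ^ 2) := by
    nlinarith [norm_add_le a b, norm_nonneg (a + b), sq_nonneg (‖a‖ - ‖b‖)]
  simp only [← ofReal_norm, ← ENNReal.ofReal_pow (norm_nonneg _)]
  rw [← ENNReal.ofReal_add (by positivity) (by positivity), ← ENNReal.ofReal_ofNat 2,
    ← ENNReal.ofReal_mul (by norm_num)]
  exact ENNReal.ofReal_le_ofReal h

theorem aemeasurable_mul_enorm_sq {w : E → ℝ≥0∞} (hw : Measurable w)
    (u : Lp ℂ 2 (volume : Measure E)) : AEMeasurable (fun ξ => w ξ * ‖u ξ‖ₑ ^ 2) := by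
  have := (Lp.aestronglyMeasurable u).enorm
  fun_prop

theorem fourierNormSq_add_le {w : E → ℝ≥0∞} (hw : Measurable w)
    (u v : Lp ℂ 2 (volume : Measure E)) :
    fourierNormSq w (u + v) ≤ 2 * (fourierNormSq w u + fourierNormSq w v) := by
  unfold fourierNormSq
  rw [← lintegral_add_left' (aemeasurable_mul_enorm_sq hw _), ← lintegral_const_mul']
  · have h : (𝓕 (u + v) : Lp ℂ 2 (volume : Measure E)) = 𝓕 u + 𝓕 v := FourierAdd.fourier_add u v
    refine lintegral_mono_ae ?_
    rw [h]
    filter_upwards [Lp.coeFn_add (𝓕 u) (𝓕 v)] with ξ hξ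
    rw [hξ, Pi.add_apply, ← mul_add, mul_left_comm]
    gcongr
    exact enorm_add_sq_le _ _
  · finiteness

theorem fourierNormSq_neg (w : E → ℝ≥0∞) (u : Lp ℂ 2 (volume : Measure E)) :
    fourierNormSq w (-u) = fourierNormSq w u := by
  have h : (𝓕 (-u) : Lp ℂ 2 (volume : Measure E)) = -𝓕 u := (Lp.fourierTransformₗᵢ E ℂ).map_neg u
  unfold fourierNormSq
  rw [h]
  refine lintegral_congr_ae ?_
  filter_upwards [Lp.coeFn_neg (𝓕 u)] with ξ hξ
  rw [hξ, Pi.neg_apply, enorm_neg]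

theorem fourierNormSq_sub_le {w : E → ℝ≥0∞} (hw : Measurable w)
    (u v : Lp ℂ 2 (volume : Measure E)) :
    fourierNormSq w (u - v) ≤ 2 * (fourierNormSq w u + fourierNormSq w v) := by
  rw [sub_eq_add_neg, ← fourierNormSq_neg w v]
  exact fourierNormSq_add_le hw _ _

theorem fourierNormSq_mono {w₁ w₂ : E → ℝ≥0∞} (h : ∀ ξ, w₁ ξ ≤ w₂ ξ)
    (u : Lp ℂ 2 (volume : Measure E)) : fourierNormSq w₁ u ≤ fourierNormSq w₂ u := by
  unfold fourierNormSq
  gcongr with ξ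
  exact h ξ

theorem fourierNormSq_const_mul {w : E → ℝ≥0∞} {c : ℝ≥0∞} (hc : c ≠ ⊤)
    (u : Lp ℂ 2 (volume : Measure E)) :
    fourierNormSq (fun ξ => c * w ξ) u = c * fourierNormSq w u := by
  unfold fourierNormSq
  simp only [mul_assoc]
  rw [lintegral_const_mul' _ _ hc]

theorem fourierNormSq_add {w₁ w₂ : E → ℝ≥0∞} (hw₁ : Measurable w₁)
    (u : Lp ℂ 2 (volume : Measure E)) :
    fourierNormSq (fun ξ => w₁ ξ + w₂ ξ) u = fourierNormSq w₁ u + fourierNormSq w₂ u := by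
  unfold fourierNormSq
  simp only [add_mul]
  rw [lintegral_add_left' (aemeasurable_mul_enorm_sq hw₁ _)]

theorem enorm_sq_eq_lintegral (u : Lp ℂ 2 (volume : Measure E)) :
    ‖u‖ₑ ^ 2 = ∫⁻ x, ‖u x‖ₑ ^ 2 := by
  have h := eLpNorm_two_withDensity_sq (w := fun _ => 1) measurable_const
    (Lp.aestronglyMeasurable u)
  rw [withDensity_const, one_smul] at h
  simpa [Lp.enorm_def] using h

/-- Plancherel's theorem. -/
theorem fourierNormSq_one (u : Lp ℂ 2 (volume : Measure E)) :
    fourierNormSq (fun _ => 1) u = ∫⁻ x, ‖u x‖ₑ ^ 2 := by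
  unfold fourierNormSq
  simp only [one_mul]
  rw [← enorm_sq_eq_lintegral, ← enorm_sq_eq_lintegral, ← ofReal_norm, ← ofReal_norm,
    Lp.norm_fourier_eq]

/-- The Fourier weight of the inhomogeneous Sobolev norm of order `s`. -/
noncomputable def sobolevWeight (s : ℝ) (ξ : E) : ℝ≥0∞ :=
  ENNReal.ofReal (1 + (2 * Real.pi * ‖ξ‖) ^ (2 * s))

/-- The weight `(t + |ξ|)^{2s}`. -/
noncomputable def scaledWeight (s t : ℝ) (ξ : E) : ℝ≥0∞ :=
  ENNReal.ofReal ((t + ‖ξ‖) ^ (2 * s))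

@[fun_prop]
theorem measurable_sobolevWeight (s : ℝ) : Measurable (sobolevWeight s : E → ℝ≥0∞) := by
  unfold sobolevWeight; fun_prop

@[fun_prop]
theorem measurable_scaledWeight (s t : ℝ) : Measurable (scaledWeight s t : E → ℝ≥0∞) := by
  unfold scaledWeight; fun_prop

theorem sobolevWeight_le_scaledWeight {s t : ℝ} (hs : 0 ≤ s) (ht : 1 ≤ t) (ξ : E) :
    sobolevWeight s ξ ≤
      ENNReal.ofReal (1 + (2 * Real.pi) ^ (2 * s)) * scaledWeight s t ξ := by
  unfold sobolevWeight scaledWeight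
  have hπ := Real.pi_pos
  have hξ := norm_nonneg ξ
  rw [← ENNReal.ofReal_mul (by positivity)]
  refine ENNReal.ofReal_le_ofReal ?_
  rw [Real.mul_rpow (by positivity) hξ, add_mul]
  gcongr
  · rw [one_mul]
    exact Real.one_le_rpow (by linarith) (by linarith)
  · linarith

theorem scaledWeight_one_le_sobolevWeight {s : ℝ} (hs : 0 ≤ s) (ξ : E) :
    scaledWeight s 1 ξ ≤ ENNReal.ofReal (2 ^ (2 * s)) * sobolevWeight s ξ := by
  unfold sobolevWeight scaledWeight
  have hπ := Real.pi_gt_three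
  have hξ := norm_nonneg ξ
  rw [← ENNReal.ofReal_mul (by positivity)]
  refine ENNReal.ofReal_le_ofReal ?_
  rcases le_total ‖ξ‖ 1 with h | h
  · calc (1 + ‖ξ‖) ^ (2 * s) ≤ 2 ^ (2 * s) := by gcongr; linarith
      _ ≤ 2 ^ (2 * s) * (1 + (2 * Real.pi * ‖ξ‖) ^ (2 * s)) :=
        le_mul_of_one_le_right (by positivity) (by simp; positivity)
  · calc (1 + ‖ξ‖) ^ (2 * s) ≤ (2 * (2 * Real.pi * ‖ξ‖)) ^ (2 * s) := by
          gcongr; nlinarith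
      _ = 2 ^ (2 * s) * (2 * Real.pi * ‖ξ‖) ^ (2 * s) := Real.mul_rpow (by positivity) (by positivity)
      _ ≤ _ := by gcongr; linarith

/-- Trades a real power for an integer one, to which Schwartz decay estimates apply. -/
theorem one_add_mul_rpow_le {M r a : ℝ} {k : ℕ} (hM : 0 ≤ M) (ha : 0 ≤ a) (hk : r ≤ k) :
    (1 + M * a) ^ r ≤ (1 + M) ^ k * 2 ^ k * (1 + a ^ k) := by
  calc (1 + M * a) ^ r ≤ (1 + M * a) ^ (k : ℝ) :=
        Real.rpow_le_rpow_of_exponent_le (by nlinarith [mul_nonneg hM ha]) hk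
    _ = (1 + M * a) ^ k := Real.rpow_natCast _ _
    _ ≤ ((1 + M) * (1 + a)) ^ k := by gcongr; nlinarith
    _ = (1 + M) ^ k * (1 + a) ^ k := mul_pow _ _ _
    _ ≤ (1 + M) ^ k * (2 ^ k * (1 + a ^ k)) := by
        gcongr
        calc (1 + a) ^ k ≤ 2 ^ (k - 1) * (1 ^ k + a ^ k) := add_pow_le zero_le_one ha k
          _ ≤ 2 ^ k * (1 + a ^ k) := by
            rw [one_pow]; gcongr
            · norm_num
            · omega
    _ = _ := by ring

theorem lintegral_enorm_mul_rpow_ne_top (g : 𝓢(Q, ℂ)) (r : ℝ) {M : ℝ} (hM : 0 ≤ M) :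
    ∫⁻ q, ‖g q‖ₑ * ENNReal.ofReal ((1 + M * ‖q‖) ^ r) ≠ ⊤ := by
  obtain ⟨k, hk⟩ := exists_nat_ge r
  have hint : Integrable fun q => (1 + M) ^ k * 2 ^ k * (‖q‖ ^ 0 * ‖g q‖ + ‖q‖ ^ k * ‖g q‖) :=
    ((g.integrable_pow_mul volume 0).add (g.integrable_pow_mul volume k)).const_mul _
  refine ne_top_of_le_ne_top hint.hasFiniteIntegral.ne (lintegral_mono fun q => ?_)
  rw [← ofReal_norm, ← ENNReal.ofReal_mul (norm_nonneg _)]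
  refine (ENNReal.ofReal_le_ofReal ?_).trans_eq (Real.enorm_eq_ofReal (by positivity)).symm
  calc ‖g q‖ * (1 + M * ‖q‖) ^ r ≤ ‖g q‖ * ((1 + M) ^ k * 2 ^ k * (1 + ‖q‖ ^ k)) := by
        gcongr
        exact one_add_mul_rpow_le hM (norm_nonneg _) hk
    _ = _ := by ring

/-- Multiplication by `η ∘ ℓ` is bounded for the norm with weight `(t + |ξ|)^{2s}`, uniformly in
`t` and in the maps `ℓ` of norm at most `t M`; when it moves frequencies outside of `B` to
frequencies outside of `A`, the bound localizes. -/
theorem exists_fourierNormSq_mulL2_le (η : 𝓢(Q, ℂ)) {s M : ℝ} (hs : 0 ≤ s) (hM : 0 ≤ M) :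
    ∃ C : ℝ≥0∞, C ≠ ⊤ ∧ ∀ (t : ℝ) (_ : 0 ≤ t) (ℓ : E →L[ℝ] Q) (_ : ‖ℓ‖ ≤ t * M) (A B : Set E)
      (_ : MeasurableSet A) (_ : MeasurableSet B)
      (_ : ∀ q ξ, 𝓕 η q ≠ 0 → ξ + ℓ.adjoint q ∈ A → ξ ∈ B) (u : Lp ℂ 2 (volume : Measure E)),
      fourierNormSq (A.indicator (scaledWeight s t)) (mulL2 (pullback η ℓ) u) ≤
        C * fourierNormSq (B.indicator (scaledWeight s t)) u := by
  -- Here `K q = (1 + M‖q‖)^{2s}`, from `t + ‖ξ + ℓ* q‖ ≤ t + ‖ξ‖ + tM‖q‖ ≤ (1 + M‖q‖)(t + ‖ξ‖)`;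
  -- the scale `t` drops out of the constant.
  have hK := lintegral_enorm_mul_rpow_ne_top (𝓕 η) (2 * s) hM
  refine ⟨_, ENNReal.mul_ne_top
    (by simpa [hasFiniteIntegral_iff_enorm] using (𝓕 η).integrable (μ := volume).hasFiniteIntegral.ne) hK,
    fun t ht ℓ hℓ A B hA hB hAB u => ?_⟩
  refine lintegral_fourier_mulL2_le η ℓ u ((measurable_scaledWeight s t).indicator hA)
    ((measurable_scaledWeight s t).indicator hB) (by fun_prop) (fun q => ?_) hK fun q ξ hq => ?_
  · rw [← ENNReal.ofReal_one]
    refine ENNReal.ofReal_le_ofReal (Real.one_le_rpow ?_ (by linarith))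
    nlinarith [mul_nonneg hM (norm_nonneg q)]
  · by_cases hmem : ξ + ℓ.adjoint q ∈ A
    · rw [Set.indicator_of_mem hmem, Set.indicator_of_mem (hAB q ξ hq hmem)]
      unfold scaledWeight
      rw [← ENNReal.ofReal_mul (by positivity), ← Real.mul_rpow (by positivity) (by positivity)]
      refine ENNReal.ofReal_le_ofReal (Real.rpow_le_rpow (by positivity) ?_ (by linarith))
      have h₁ : ‖ℓ.adjoint q‖ ≤ t * M * ‖q‖ := by
        refine (ℓ.adjoint.le_opNorm q).trans ?_
        rw [LinearIsometryEquiv.norm_map]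
        gcongr
      nlinarith [norm_add_le ξ (ℓ.adjoint q), norm_nonneg ξ, norm_nonneg q,
        mul_nonneg (norm_nonneg ξ) (mul_nonneg hM (norm_nonneg q))]
    · simp [hmem]

theorem exists_fourierNormSq_sobolevWeight_mulL2_le (η : 𝓢(Q, ℂ)) {s M : ℝ} (hs : 0 ≤ s)
    (hM : 0 ≤ M) :
    ∃ C : ℝ≥0∞, C ≠ ⊤ ∧ ∀ (ℓ : E →L[ℝ] Q) (_ : ‖ℓ‖ ≤ M) (u : Lp ℂ 2 (volume : Measure E)),
      fourierNormSq (sobolevWeight s) (mulL2 (pullback η ℓ) u) ≤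
        C * fourierNormSq (sobolevWeight s) u := by
  obtain ⟨C, hC, h⟩ := exists_fourierNormSq_mulL2_le (E := E) η hs hM
  refine ⟨ENNReal.ofReal (1 + (2 * Real.pi) ^ (2 * s)) * (C * ENNReal.ofReal (2 ^ (2 * s))),
    by finiteness, fun ℓ hℓ u => ?_⟩
  have h₁ := h 1 zero_le_one ℓ (by simpa using hℓ) Set.univ Set.univ .univ .univ (by simp) u
  simp only [Set.indicator_univ] at h₁
  calc _ ≤ _ := fourierNormSq_mono (sobolevWeight_le_scaledWeight hs le_rfl) _
    _ = _ := fourierNormSq_const_mul (by finiteness) _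
    _ ≤ _ := mul_le_mul_right h₁ _
    _ ≤ _ := mul_le_mul_right (mul_le_mul_right
      (fourierNormSq_mono (scaledWeight_one_le_sobolevWeight hs) _) _) _
    _ = _ := by rw [fourierNormSq_const_mul (by finiteness)]; ring

/-- A smooth cutoff near the origin that factors through a function with compactly supported
Fourier transform. -/
theorem exists_cutoff_factorization (Q : Type*) [NormedAddCommGroup Q] [InnerProductSpace ℝ Q]
    [FiniteDimensional ℝ Q] [MeasurableSpace Q] [BorelSpace Q] :
    ∃ (γ κ : 𝓢(Q, ℂ)) (ρ r R : ℝ), 0 < r ∧ 0 < R ∧ 0 ≤ ρ ∧ (∀ q, 𝓕 γ q ≠ 0 → ‖q‖ ≤ ρ) ∧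
      (∀ y, ‖y‖ < r → κ y * γ y = 1) ∧ ∀ y, κ y ≠ 0 → ‖y‖ < R := by
  let b : ContDiffBump (0 : Q) := ⟨1, 2, one_pos, one_lt_two⟩
  have hb : HasCompactSupport fun q => (b q : ℂ) :=
    b.hasCompactSupport.comp_left (g := Complex.ofReal) Complex.ofReal_zero
  let g : 𝓢(Q, ℂ) := hb.toSchwartzMap (Complex.ofRealCLM.contDiff.comp b.contDiff)
  have hg : ∀ q, g q = (b q : ℂ) := fun q => rfl
  -- Prescribing the Fourier transform as a bump gives compact frequency support, and `γ 0` is the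
  -- integral of the bump, hence nonzero.
  let γ : 𝓢(Q, ℂ) := 𝓕⁻ g
  have hFγ : 𝓕 γ = g := FourierTransform.fourier_fourierInv_eq g
  have hγ₀ : γ 0 ≠ 0 := by
    have : γ 0 = ((∫ q, b q : ℝ) : ℂ) := by
      change (𝓕⁻ g) 0 = _
      rw [fourierInv_coe, Real.fourierInv_eq]
      simp [hg, integral_complex_ofReal]
    rw [this]
    exact_mod_cast (b.integral_pos (μ := volume)).ne'
  obtain ⟨r₀, hr₀, hball⟩ := Metric.eventually_nhds_iff.1
    ((γ.continuous.tendsto 0).eventually_ne hγ₀)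
  -- `κ` is `b' / γ`. The outer radius `r₀ / 2` lies strictly inside the ball where `γ ≠ 0`, so the
  -- quotient is smooth everywhere.
  let b' : ContDiffBump (0 : Q) := ⟨r₀ / 4, r₀ / 2, by positivity, by linarith⟩
  have hb' : HasCompactSupport fun q => (b' q : ℂ) :=
    b'.hasCompactSupport.comp_left (g := Complex.ofReal) Complex.ofReal_zero
  have hcd' : ContDiff ℝ ∞ fun q => (b' q : ℂ) := Complex.ofRealCLM.contDiff.comp b'.contDiff
  have hcs : HasCompactSupport fun y => (b' y : ℂ) / γ y := by
    simp only [div_eq_mul_inv]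
    exact hb'.mul_right
  have hcd : ContDiff ℝ ∞ fun y => (b' y : ℂ) / γ y := by
    rw [contDiff_iff_contDiffAt]
    intro y
    by_cases hy : ‖y‖ < r₀
    · simp only [div_eq_mul_inv]
      exact hcd'.contDiffAt.mul ((γ.smooth ⊤).contDiffAt.inv (hball (by simpa using hy)))
    · have : (fun y => (b' y : ℂ) / γ y) =ᶠ[𝓝 y] fun _ => 0 := by
        have hopen : {z : Q | r₀ / 2 < ‖z‖} ∈ 𝓝 y :=
          (isOpen_lt continuous_const continuous_norm).mem_nhds
            (show r₀ / 2 < ‖y‖ by linarith)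
        filter_upwards [hopen] with z hz
        rw [b'.zero_of_le_dist (by simpa using (le_of_lt hz))]
        simp
      exact contDiffAt_const.congr_of_eventuallyEq this
  refine ⟨γ, hcs.toSchwartzMap hcd, 2, r₀ / 4, r₀ / 2, by positivity, by positivity, by norm_num,
    fun q hq => ?_, fun y hy => ?_, fun y hy => ?_⟩
  · by_contra! hlt
    refine hq ?_
    rw [hFγ, hg, b.zero_of_le_dist (by simpa using hlt.le), Complex.ofReal_zero]
  · change (b' y : ℂ) / γ y * γ y = 1
    rw [div_mul_cancel₀ _ (hball (by simp; linarith)),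
      b'.one_of_mem_closedBall (by simpa using hy.le), Complex.ofReal_one]
  · by_contra! hle
    refine hy ?_
    change (b' y : ℂ) / γ y = 0
    rw [b'.zero_of_le_dist (by simpa using hle), Complex.ofReal_zero, zero_div]

end FourierNorm

/-! ### Vanishing of the part near a kernel -/

section SobolevLimits

open SchwartzMap Filter Topology

variable {E Q : Type*} [NormedAddCommGroup E] [InnerProductSpace ℝ E] [FiniteDimensional ℝ E]
  [MeasurableSpace E] [BorelSpace E]
  [NormedAddCommGroup Q] [InnerProductSpace ℝ Q] [FiniteDimensional ℝ Q]
  [MeasurableSpace Q] [BorelSpace Q]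

/-- Boundedness alone would give a majorant; the extra decay `1 / (1 + ‖z‖)` supplies the pointwise
limit under dilation. -/
theorem exists_rpow_mul_norm_sq_le (γ : 𝓢(Q, ℂ)) {s : ℝ} (hs : 0 ≤ s) :
    ∃ C : ℝ, 0 ≤ C ∧ ∀ z, ‖z‖ ^ (2 * s) * ‖γ z‖ ^ 2 ≤ C / (1 + ‖z‖) := by
  obtain ⟨k, hk⟩ := exists_nat_ge (s + 1)
  obtain ⟨C₀, h₀⟩ := γ.decay 0 0
  obtain ⟨C₁, h₁⟩ := γ.decay k 0
  have hb : ∀ z, ‖z‖ ^ s * (1 + ‖z‖) * ‖γ z‖ ≤ (1 + 1) ^ k * 2 ^ k * (C₀ + C₁) := by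
    intro z
    have h₀ := h₀.2 z
    have h₁ := h₁.2 z
    simp only [norm_iteratedFDeriv_zero, pow_zero, one_mul] at h₀ h₁
    calc ‖z‖ ^ s * (1 + ‖z‖) * ‖γ z‖ ≤ (1 + ‖z‖) ^ s * (1 + ‖z‖) * ‖γ z‖ := by
          gcongr; linarith [norm_nonneg z]
      _ = (1 + 1 * ‖z‖) ^ (s + 1) * ‖γ z‖ := by
          rw [one_mul, Real.rpow_add_one (by positivity)]
      _ ≤ (1 + 1) ^ k * 2 ^ k * (1 + ‖z‖ ^ k) * ‖γ z‖ := by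
          gcongr
          exact one_add_mul_rpow_le zero_le_one (norm_nonneg z) hk
      _ = (1 + 1) ^ k * 2 ^ k * (‖γ z‖ + ‖z‖ ^ k * ‖γ z‖) := by ring
      _ ≤ _ := by gcongr
  refine ⟨((1 + 1) ^ k * 2 ^ k * (C₀ + C₁)) ^ 2, by positivity, fun z => ?_⟩
  rw [le_div_iff₀ (by positivity)]
  calc ‖z‖ ^ (2 * s) * ‖γ z‖ ^ 2 * (1 + ‖z‖)
      ≤ ‖z‖ ^ (2 * s) * ‖γ z‖ ^ 2 * (1 + ‖z‖) ^ 2 := by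
        gcongr
        nlinarith [norm_nonneg z]
    _ = (‖z‖ ^ s * (1 + ‖z‖) * ‖γ z‖) ^ 2 := by
        rw [mul_comm 2 s, Real.rpow_mul (norm_nonneg z), Real.rpow_two]; ring
    _ ≤ _ := pow_le_pow_left₀ (by positivity) (hb z) 2

/-- With `z = nℓx`, `n^{2s}‖γ z‖² = ‖ℓx‖^{-2s} · ‖z‖^{2s}‖γ z‖²` off the kernel. The second factor
is bounded and tends to zero, so dominated convergence applies. -/
theorem tendsto_lintegral_dilated_mul (γ : 𝓢(Q, ℂ)) (ℓ : E →L[ℝ] Q) {s : ℝ} (hs : 0 < s)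
    (u : Lp ℂ 2 (volume : Measure E)) (hI : ∫⁻ x, ‖ℓ x‖ₑ ^ (-(2 * s)) * ‖u x‖ₑ ^ 2 ≠ ⊤) :
    Tendsto (fun n : ℕ => ∫⁻ x, ENNReal.ofReal ((n : ℝ) ^ (2 * s)) *
      (‖γ ((n : ℝ) • ℓ x)‖ₑ ^ 2 * ‖u x‖ₑ ^ 2)) atTop (𝓝 0) := by
  obtain ⟨C, hC, hb⟩ := exists_rpow_mul_norm_sq_le γ hs.le
  have hmeas : AEMeasurable fun x => ‖ℓ x‖ₑ ^ (-(2 * s)) * ‖u x‖ₑ ^ 2 :=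
    aemeasurable_mul_enorm_sq (w := fun x => ‖ℓ x‖ₑ ^ (-(2 * s)))
      (ℓ.continuous.enorm.measurable.pow_const _) u
  -- On the kernel the weight is `0 ^ (-2s) = ⊤`, so the finite integral forces `u = 0` there.
  have hzero : ∀ᵐ x, ℓ x = 0 → u x = 0 := by
    filter_upwards [ae_lt_top' hmeas hI] with x hx h0
    by_contra hu
    rw [h0, enorm_zero, ENNReal.zero_rpow_of_neg (by linarith), ENNReal.top_mul (by simpa)] at hx
    exact lt_irrefl _ hx
  have hle : ∀ n : ℕ, ∀ᵐ x, ENNReal.ofReal ((n : ℝ) ^ (2 * s)) *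
      (‖γ ((n : ℝ) • ℓ x)‖ₑ ^ 2 * ‖u x‖ₑ ^ 2) ≤
      ‖ℓ x‖ₑ ^ (-(2 * s)) * ‖u x‖ₑ ^ 2 * ENNReal.ofReal (C / (1 + n * ‖ℓ x‖)) := by
    intro n
    filter_upwards [hzero] with x hx
    by_cases h0 : ℓ x = 0
    · simp [hx h0]
    have hpos : 0 < ‖ℓ x‖ := norm_pos_iff.2 h0
    rw [← ofReal_norm (ℓ x), ENNReal.ofReal_rpow_of_pos hpos, mul_right_comm, ← mul_assoc,
      ← ofReal_norm (γ _), ← ENNReal.ofReal_pow (norm_nonneg _), ← ENNReal.ofReal_mul (by positivity),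
      ← ENNReal.ofReal_mul (by positivity)]
    refine mul_le_mul_left (ENNReal.ofReal_le_ofReal ?_) _
    have := hb ((n : ℝ) • ℓ x)
    rw [norm_smul, Real.norm_natCast, Real.mul_rpow (by positivity) hpos.le] at this
    rw [Real.rpow_neg hpos.le]
    calc (n : ℝ) ^ (2 * s) * ‖γ ((n : ℝ) • ℓ x)‖ ^ 2 = (‖ℓ x‖ ^ (2 * s))⁻¹ *
          ((n : ℝ) ^ (2 * s) * ‖ℓ x‖ ^ (2 * s) * ‖γ ((n : ℝ) • ℓ x)‖ ^ 2) := by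
          have : ‖ℓ x‖ ^ (2 * s) ≠ 0 := by positivity
          field_simp
      _ ≤ _ := by gcongr
  refine tendsto_of_tendsto_of_tendsto_of_le_of_le tendsto_const_nhds ?_ (fun _ => zero_le)
    fun n => lintegral_mono_ae (hle n)
  have hlim := tendsto_lintegral_of_dominated_convergence' (μ := (volume : Measure E))
    (F := fun (n : ℕ) x => ‖ℓ x‖ₑ ^ (-(2 * s)) * ‖u x‖ₑ ^ 2 *
      ENNReal.ofReal (C / (1 + n * ‖ℓ x‖))) (f := fun _ => 0)
    (fun x => ‖ℓ x‖ₑ ^ (-(2 * s)) * ‖u x‖ₑ ^ 2 * ENNReal.ofReal C)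
    (fun n => hmeas.mul (by fun_prop)) (fun n => .of_forall fun x => ?_) ?_ ?_
  · simpa using hlim
  · refine mul_le_mul_right (ENNReal.ofReal_le_ofReal ?_) _
    exact div_le_self hC (by simp; positivity)
  · rw [lintegral_mul_const' _ _ (by finiteness)]
    finiteness
  · filter_upwards [hzero, ae_lt_top' hmeas hI] with x hx hfin
    by_cases h0 : ℓ x = 0
    · simp [hx h0]
    have hpos : 0 < ‖ℓ x‖ := norm_pos_iff.2 h0
    have h1 : Tendsto (fun n : ℕ => C / (1 + n * ‖ℓ x‖)) atTop (𝓝 0) :=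
      (tendsto_const_nhds (x := C)).div_atTop
        (tendsto_atTop_add_const_left _ _ (tendsto_natCast_atTop_atTop.atTop_mul_const hpos))
    have h2 := ENNReal.Tendsto.const_mul (a := ‖ℓ x‖ₑ ^ (-(2 * s)) * ‖u x‖ₑ ^ 2)
      (ENNReal.tendsto_ofReal h1) (.inr hfin.ne)
    simpa using h2

/-- Where `n < ‖ξ‖`, `n + ‖ξ‖ ≤ 2π‖ξ‖`, so the Sobolev weight dominates; each fixed `ξ` leaves the
region as `n` grows. -/
theorem tendsto_fourierNormSq_indicator {s : ℝ} (hs : 0 ≤ s) (u : Lp ℂ 2 (volume : Measure E))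
    (hu : fourierNormSq (sobolevWeight s) u ≠ ⊤) :
    Tendsto (fun n : ℕ => fourierNormSq ({ξ | (n : ℝ) < ‖ξ‖}.indicator (scaledWeight s n)) u)
      atTop (𝓝 0) := by
  have hA : ∀ n : ℕ, MeasurableSet {ξ : E | (n : ℝ) < ‖ξ‖} := fun n =>
    measurableSet_lt measurable_const measurable_norm
  have hlim := tendsto_lintegral_of_dominated_convergence' (μ := (volume : Measure E))
    (F := fun (n : ℕ) ξ => {ξ : E | (n : ℝ) < ‖ξ‖}.indicator (scaledWeight s n) ξ *
      ‖(𝓕 u : Lp ℂ 2 (volume : Measure E)) ξ‖ₑ ^ 2) (f := fun _ => 0)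
    (fun ξ => sobolevWeight s ξ * ‖(𝓕 u : Lp ℂ 2 (volume : Measure E)) ξ‖ₑ ^ 2)
    (fun n => aemeasurable_mul_enorm_sq ((measurable_scaledWeight s n).indicator (hA n)) _)
    (fun n => .of_forall fun ξ => ?_) hu (.of_forall fun ξ => ?_)
  · simpa [fourierNormSq] using hlim
  · dsimp only
    gcongr
    by_cases hξ : (n : ℝ) < ‖ξ‖
    · rw [Set.indicator_of_mem (by exact hξ)]
      unfold sobolevWeight scaledWeight
      refine ENNReal.ofReal_le_ofReal ?_
      calc ((n : ℝ) + ‖ξ‖) ^ (2 * s) ≤ (2 * Real.pi * ‖ξ‖) ^ (2 * s) := by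
            have := Real.pi_gt_three
            gcongr
            nlinarith [norm_nonneg ξ]
        _ ≤ _ := by linarith
    · simp [hξ]
  · obtain ⟨k, hk⟩ := exists_nat_ge ‖ξ‖
    refine tendsto_const_nhds.congr' ?_
    filter_upwards [eventually_ge_atTop k] with n hn
    rw [Set.indicator_of_notMem, zero_mul]
    simpa using hk.trans (by exact_mod_cast hn)

/-- Below the threshold `c t` the weight is at most `((1 + c) t)^{2s}`, and Plancherel returns that
part to position space. -/
theorem fourierNormSq_scaledWeight_le {s t c : ℝ} (hs : 0 ≤ s) (ht : 0 ≤ t) (hc : 0 ≤ c)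
    (u : Lp ℂ 2 (volume : Measure E)) :
    fourierNormSq (scaledWeight s t) u ≤
      fourierNormSq ({ξ | c * t < ‖ξ‖}.indicator (scaledWeight s t)) u +
      ENNReal.ofReal ((1 + c) ^ (2 * s)) * ∫⁻ x, ENNReal.ofReal (t ^ (2 * s)) * ‖u x‖ₑ ^ 2 := by
  have hA : MeasurableSet {ξ : E | c * t < ‖ξ‖} :=
    measurableSet_lt measurable_const measurable_norm
  rw [lintegral_const_mul' _ _ (by finiteness), ← fourierNormSq_one, ← mul_assoc,
    ← fourierNormSq_const_mul (by finiteness),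
    ← fourierNormSq_add ((measurable_scaledWeight s t).indicator hA)]
  refine fourierNormSq_mono (fun ξ => ?_) _
  by_cases hξ : c * t < ‖ξ‖
  · rw [Set.indicator_of_mem (by exact hξ)]
    exact le_self_add
  · refine le_add_left ?_
    unfold scaledWeight
    rw [mul_one, ← ENNReal.ofReal_mul (by positivity), ← Real.mul_rpow (by positivity) ht]
    gcongr
    linarith

/-- If `u ∈ H^s` and `|ℓ|^{-s} u ∈ L²` then the part of `u` near the kernel of `ℓ` vanishes in `H^s`
in the limit. -/
theorem tendsto_fourierNormSq_mulL2 {γ : 𝓢(Q, ℂ)} (κ : 𝓢(Q, ℂ)) {ρ : ℝ} (hρ : 0 ≤ ρ)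
    (hγ : ∀ q, 𝓕 γ q ≠ 0 → ‖q‖ ≤ ρ) (ℓ : E →L[ℝ] Q) {s : ℝ} (hs : 0 < s)
    (u : Lp ℂ 2 (volume : Measure E)) (hu : fourierNormSq (sobolevWeight s) u ≠ ⊤)
    (hI : ∫⁻ x, ‖ℓ x‖ₑ ^ (-(2 * s)) * ‖u x‖ₑ ^ 2 ≠ ⊤) :
    Tendsto (fun n : ℕ => fourierNormSq (sobolevWeight s)
      (mulL2 (pullback κ ((n : ℝ) • ℓ)) (mulL2 (pullback γ ((n : ℝ) • ℓ)) u))) atTop (𝓝 0) := by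
  obtain ⟨C₁, hC₁, h₁⟩ := exists_fourierNormSq_mulL2_le (E := E) κ hs.le (norm_nonneg ℓ)
  obtain ⟨C₂, hC₂, h₂⟩ := exists_fourierNormSq_mulL2_le (E := E) γ hs.le (norm_nonneg ℓ)
  set C₀ := ENNReal.ofReal (1 + (2 * Real.pi) ^ (2 * s)) with hC₀
  -- Multiplication by `γ(nℓ·)` shifts frequencies by at most `n‖ℓ‖ρ`, so output above `c n` comes
  -- only from input above `n`.
  set c := 1 + ‖ℓ‖ * ρ with hc
  have hc0 : 0 ≤ c := by positivity
  have hnorm : ∀ n : ℕ, ‖(n : ℝ) • ℓ‖ ≤ n * ‖ℓ‖ := fun n => by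
    rw [norm_smul, Real.norm_natCast]
  have hbound : ∀ n : ℕ, 1 ≤ n → fourierNormSq (sobolevWeight s)
      (mulL2 (pullback κ ((n : ℝ) • ℓ)) (mulL2 (pullback γ ((n : ℝ) • ℓ)) u)) ≤
      C₀ * (C₁ * (C₂ * fourierNormSq ({ξ | (n : ℝ) < ‖ξ‖}.indicator (scaledWeight s n)) u +
        ENNReal.ofReal ((1 + c) ^ (2 * s)) * ∫⁻ x, ENNReal.ofReal ((n : ℝ) ^ (2 * s)) *
          (‖γ ((n : ℝ) • ℓ x)‖ₑ ^ 2 * ‖u x‖ₑ ^ 2))) := by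
    intro n hn
    have hn0 : (0 : ℝ) ≤ n := n.cast_nonneg
    have hκ := h₁ n hn0 ((n : ℝ) • ℓ) (hnorm n) Set.univ Set.univ .univ .univ (by simp)
      (mulL2 (pullback γ ((n : ℝ) • ℓ)) u)
    simp only [Set.indicator_univ] at hκ
    refine (fourierNormSq_mono (sobolevWeight_le_scaledWeight (t := n) hs.le (by exact_mod_cast hn)) _).trans
      ((fourierNormSq_const_mul (by finiteness) _).trans_le ?_)
    gcongr
    refine hκ.trans ?_
    gcongr
    refine (fourierNormSq_scaledWeight_le hs.le hn0 hc0 _).trans ?_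
    gcongr ?_ + _ * ?_
    · refine h₂ n hn0 ((n : ℝ) • ℓ) (hnorm n) _ _
        (measurableSet_lt measurable_const measurable_norm)
        (measurableSet_lt measurable_const measurable_norm) (fun q ξ hq hξ => ?_) u
      have hℓ : ‖((n : ℝ) • ℓ).adjoint q‖ ≤ n * ‖ℓ‖ * ρ := by
        refine ((((n : ℝ) • ℓ).adjoint).le_opNorm q).trans ?_
        rw [LinearIsometryEquiv.norm_map]
        gcongr
        · exact hnorm n
        · exact hγ q hq
      simp only [Set.mem_ofPred_eq, hc] at hξ ⊢
      nlinarith [norm_add_le ξ (((n : ℝ) • ℓ).adjoint q)]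
    · refine (lintegral_congr_ae ?_).le
      filter_upwards [coeFn_mulL2 (pullback γ ((n : ℝ) • ℓ)) u] with x hx
      rw [hx, enorm_mul, mul_pow, pullback_apply]
      rfl
  have hlim := ENNReal.Tendsto.const_mul (a := C₀) (ENNReal.Tendsto.const_mul (a := C₁)
    ((ENNReal.Tendsto.const_mul (a := C₂) (tendsto_fourierNormSq_indicator hs.le u hu)
      (.inr hC₂)).add (ENNReal.Tendsto.const_mul (a := ENNReal.ofReal ((1 + c) ^ (2 * s)))
        (tendsto_lintegral_dilated_mul γ ℓ hs u hI) (.inr (by finiteness)))) (.inr hC₁))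
    (.inr (by finiteness))
  simp only [mul_zero, add_zero] at hlim
  refine tendsto_of_tendsto_of_tendsto_of_le_of_le' tendsto_const_nhds hlim
    (.of_forall fun _ => zero_le) ?_
  filter_upwards [eventually_ge_atTop 1] with n hn using hbound n hn

/-! ### Density of Schwartz functions and cutoffs at infinity -/

theorem sobolevWeight_ne_top (s : ℝ) (ξ : E) : sobolevWeight s ξ ≠ ⊤ := ENNReal.ofReal_ne_top

theorem hasTemperateGrowth_withDensity_sobolevWeight {s : ℝ} (hs : 0 ≤ s) :
    ((volume : Measure E).withDensity (sobolevWeight s)).HasTemperateGrowth := by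
  obtain ⟨k, hk⟩ := exists_nat_ge (2 * s)
  refine ⟨⟨k + (Module.finrank ℝ E + 1), ?_⟩⟩
  rw [integrable_withDensity_iff (measurable_sobolevWeight s)
    (.of_forall fun ξ => (sobolevWeight_ne_top s ξ).lt_top)]
  have hint : Integrable (fun x : E => (1 + (2 * Real.pi) ^ (2 * s)) *
      (1 + ‖x‖) ^ (-((Module.finrank ℝ E : ℝ) + 1))) :=
    (integrable_one_add_norm (by linarith)).const_mul _
  refine hint.mono (by unfold sobolevWeight; fun_prop) (.of_forall fun x => ?_)
  have hx := norm_nonneg x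
  have hπ := Real.pi_pos
  have hw : (sobolevWeight s x).toReal ≤ (1 + (2 * Real.pi) ^ (2 * s)) * (1 + ‖x‖) ^ (k : ℝ) := by
    unfold sobolevWeight
    rw [ENNReal.toReal_ofReal (by positivity), Real.mul_rpow (by positivity) hx, add_mul]
    gcongr
    · rw [one_mul]; exact Real.one_le_rpow (by linarith) (by positivity)
    · exact (Real.rpow_le_rpow hx (by linarith) (by linarith)).trans
        (Real.rpow_le_rpow_of_exponent_le (by linarith) hk)
  rw [Real.norm_of_nonneg (by positivity), Real.norm_of_nonneg (by positivity)]
  calc _ ≤ (1 + ‖x‖) ^ (-((k + (Module.finrank ℝ E + 1) : ℕ) : ℝ)) *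
        ((1 + (2 * Real.pi) ^ (2 * s)) * (1 + ‖x‖) ^ (k : ℝ)) := by gcongr
    _ = (1 + (2 * Real.pi) ^ (2 * s)) *
        ((1 + ‖x‖) ^ (-((k + (Module.finrank ℝ E + 1) : ℕ) : ℝ)) * (1 + ‖x‖) ^ (k : ℝ)) := by ring
    _ = _ := by
        rw [← Real.rpow_add (by positivity)]
        congr 2
        push_cast
        ring

theorem isLocallyFiniteMeasure_withDensity_sobolevWeight {s : ℝ} (hs : 0 ≤ s) :
    IsLocallyFiniteMeasure ((volume : Measure E).withDensity (sobolevWeight s)) := by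
  refine IsLocallyFiniteMeasure.withDensity_ofReal ?_
  exact continuous_const.add ((continuous_const.mul continuous_norm).rpow_const
    fun _ => .inr (by linarith))

theorem fourierNormSq_sobolevWeight_toLp_ne_top {s : ℝ} (hs : 0 ≤ s) (φ : 𝓢(E, ℂ)) :
    fourierNormSq (sobolevWeight s) (φ.toLp 2) ≠ ⊤ := by
  have := hasTemperateGrowth_withDensity_sobolevWeight (E := E) hs
  unfold fourierNormSq
  rw [toLp_fourier_eq, ← eLpNorm_two_withDensity_sq (by fun_prop) (Lp.aestronglyMeasurable _),
    eLpNorm_congr_ae ((withDensity_absolutelyContinuous _ _).ae_eq ((𝓕 φ).coeFn_toLp 2 volume))]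
  exact ENNReal.pow_ne_top ((𝓕 φ).memLp 2 _).2.ne

/-- Schwartz functions are dense in `H^s`. -/
theorem exists_schwartz_fourierNormSq_sub_lt {s : ℝ} (hs : 0 ≤ s)
    (u : Lp ℂ 2 (volume : Measure E)) (hu : fourierNormSq (sobolevWeight s) u ≠ ⊤) {ε : ℝ≥0∞}
    (hε : 0 < ε) : ∃ φ : 𝓢(E, ℂ), fourierNormSq (sobolevWeight s) (u - φ.toLp 2 volume) < ε := by
  have := hasTemperateGrowth_withDensity_sobolevWeight (E := E) hs
  have := isLocallyFiniteMeasure_withDensity_sobolevWeight (E := E) hs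
  set ν := (volume : Measure E).withDensity (sobolevWeight s) with hν
  have hac : ν ≪ volume := withDensity_absolutelyContinuous _ _
  set f : Lp ℂ 2 (volume : Measure E) := 𝓕 u with hf
  have hfν : MemLp f 2 ν := by
    refine ⟨(Lp.aestronglyMeasurable f).mono_ac hac, ?_⟩
    have h := eLpNorm_two_withDensity_sq (measurable_sobolevWeight (E := E) s)
      (Lp.aestronglyMeasurable f)
    refine lt_top_iff_ne_top.2 fun htop => hu ?_
    rw [fourierNormSq, ← hf, ← h, ← hν, htop]
    rfl
  obtain ⟨δ, hδ, hδε⟩ : ∃ δ : ℝ≥0∞, 0 < δ ∧ δ ^ 2 < ε := by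
    have hc := (ENNReal.continuous_pow 2).tendsto 0
    rw [zero_pow two_ne_zero] at hc
    have h0 : ∀ᶠ x : ℝ≥0∞ in 𝓝[>] 0, x ^ 2 < ε :=
      (hc.eventually (gt_mem_nhds hε)).filter_mono nhdsWithin_le_nhds
    obtain ⟨δ, h₁, h₂⟩ := (h0.and self_mem_nhdsWithin).exists
    exact ⟨δ, h₂, h₁⟩
  -- `H^s` is `L²(ν)` on the Fourier side, so `𝓕 u` is approximated there and the approximant
  -- transformed back.
  obtain ⟨ψ, hψ⟩ := (SchwartzMap.denseRange_toLpCLM (E := E) (F := ℂ) (p := 2) (μ := ν)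
    ENNReal.ofNat_ne_top).exists_mem_open (Metric.isOpen_eball (x := hfν.toLp) (ε := δ))
    ⟨hfν.toLp, Metric.mem_eball_self hδ⟩
  refine ⟨𝓕⁻ ψ, lt_of_le_of_lt ?_ hδε⟩
  have hsub : (𝓕 (u - (𝓕⁻ ψ).toLp 2) : Lp ℂ 2 (volume : Measure E)) = f - ψ.toLp 2 volume := by
    have h := (Lp.fourierTransformₗᵢ E ℂ).map_sub u ((𝓕⁻ ψ).toLp 2)
    refine Eq.trans h ?_
    congr 1
    refine (SchwartzMap.toLp_fourier_eq (𝓕⁻ ψ)).trans ?_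
    rw [FourierTransform.fourier_fourierInv_eq (E := 𝓢(E, ℂ)) (F := 𝓢(E, ℂ)) ψ]
  unfold fourierNormSq
  rw [hsub, ← eLpNorm_two_withDensity_sq (by fun_prop) (Lp.aestronglyMeasurable _), ← hν]
  gcongr
  rw [Metric.mem_eball', toLpCLM_apply, Lp.edist_def] at hψ
  refine (eLpNorm_congr_ae ?_).trans_le hψ.le
  filter_upwards [hac.ae_eq (Lp.coeFn_sub f (ψ.toLp 2 volume)), hfν.coeFn_toLp, ψ.coeFn_toLp 2 ν,
    hac.ae_eq (ψ.coeFn_toLp 2 volume)] with x h₁ h₂ h₃ h₄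
  rw [h₁, Pi.sub_apply, Pi.sub_apply, h₂, h₃, h₄]

/-- Pointwise `a ≤ δ⁻¹ + δ a²` for `a = (2π‖ξ‖)^{2s}`. A sequence bounded in `H^{2s}` and null in
`L²` is thus null in `H^s`. -/
theorem fourierNormSq_sobolevWeight_interpolation {s δ : ℝ} (hδ : 0 < δ)
    (u : Lp ℂ 2 (volume : Measure E)) :
    fourierNormSq (sobolevWeight s) u ≤ ENNReal.ofReal (1 + δ⁻¹) * (∫⁻ x, ‖u x‖ₑ ^ 2) +
      ENNReal.ofReal δ * fourierNormSq (sobolevWeight (2 * s)) u := by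
  rw [← fourierNormSq_one, ← fourierNormSq_const_mul (by finiteness),
    ← fourierNormSq_const_mul (by finiteness), ← fourierNormSq_add (by fun_prop)]
  refine fourierNormSq_mono (fun ξ => ?_) _
  unfold sobolevWeight
  rw [mul_one, ← ENNReal.ofReal_mul hδ.le, ← ENNReal.ofReal_add (by positivity) (by positivity)]
  refine ENNReal.ofReal_le_ofReal ?_
  have h : (2 * Real.pi * ‖ξ‖) ^ (2 * (2 * s)) = ((2 * Real.pi * ‖ξ‖) ^ (2 * s)) ^ 2 := by
    rw [← Real.rpow_two, ← Real.rpow_mul (by positivity)]; ring_nf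
  rw [h]
  set a := (2 * Real.pi * ‖ξ‖) ^ (2 * s)
  have ha : 0 ≤ a := by positivity
  rcases le_total a δ⁻¹ with h | h
  · nlinarith [mul_nonneg hδ.le (sq_nonneg a)]
  · have : 1 ≤ δ * a := by
      calc 1 = δ * δ⁻¹ := by field_simp
        _ ≤ _ := by gcongr
    nlinarith [inv_pos.2 hδ]

theorem tendsto_lintegral_sub_dilated_cutoff {θ : 𝓢(E, ℂ)} (hθ : θ 0 = 1)
    (u : Lp ℂ 2 (volume : Measure E)) :
    Tendsto (fun n : ℕ => ∫⁻ x, ‖(u - mulL2 (pullback θ ((n : ℝ)⁻¹ • .id ℝ E)) u :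
      Lp ℂ 2 (volume : Measure E)) x‖ₑ ^ 2) atTop (𝓝 0) := by
  obtain ⟨C, hC⟩ := θ.decay 0 0
  have hC : ∀ x, ‖1 - θ x‖ₑ ≤ ENNReal.ofReal (1 + C) := fun x => by
    rw [← ofReal_norm]
    refine ENNReal.ofReal_le_ofReal ((norm_sub_le _ _).trans ?_)
    have := hC.2 x
    simp only [norm_iteratedFDeriv_zero, pow_zero, one_mul] at this
    simpa using this
  have he : ∀ n : ℕ, ∫⁻ x, ‖(u - mulL2 (pullback θ ((n : ℝ)⁻¹ • .id ℝ E)) u :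
      Lp ℂ 2 (volume : Measure E)) x‖ₑ ^ 2 = ∫⁻ x, ‖1 - θ ((n : ℝ)⁻¹ • x)‖ₑ ^ 2 * ‖u x‖ₑ ^ 2 := by
    intro n
    refine lintegral_congr_ae ?_
    filter_upwards [Lp.coeFn_sub u (mulL2 (pullback θ ((n : ℝ)⁻¹ • .id ℝ E)) u),
      coeFn_mulL2 (pullback θ ((n : ℝ)⁻¹ • .id ℝ E)) u] with x h₁ h₂
    rw [h₁, Pi.sub_apply, h₂, ← mul_pow, ← enorm_mul]
    simp [sub_mul]
  simp only [he]
  have hlim := tendsto_lintegral_of_dominated_convergence' (μ := (volume : Measure E))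
    (F := fun (n : ℕ) x => ‖1 - θ ((n : ℝ)⁻¹ • x)‖ₑ ^ 2 * ‖u x‖ₑ ^ 2) (f := fun _ => 0)
    (fun x => ENNReal.ofReal (1 + C) ^ 2 * ‖u x‖ₑ ^ 2)
    (fun n => ?_) (fun n => .of_forall fun x => ?_) ?_ (.of_forall fun x => ?_)
  · simpa using hlim
  · have := θ.continuous
    exact aemeasurable_mul_enorm_sq (w := fun x => ‖1 - θ ((n : ℝ)⁻¹ • x)‖ₑ ^ 2)
      (Continuous.measurable (by fun_prop)) u
  · dsimp only
    gcongr
    exact hC _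
  · rw [lintegral_const_mul' _ _ (by finiteness), ← enorm_sq_eq_lintegral]
    finiteness
  · have h1 : Tendsto (fun n : ℕ => (n : ℝ)⁻¹ • x) atTop (𝓝 0) := by
      simpa using (tendsto_inv_atTop_nhds_zero_nat (𝕜 := ℝ)).smul_const x
    have h2 : Tendsto (fun n : ℕ => ‖1 - θ ((n : ℝ)⁻¹ • x)‖ₑ ^ 2) atTop (𝓝 0) := by
      have h3 := ((tendsto_const_nhds (x := (1 : ℂ))).sub ((θ.continuous.tendsto 0).comp h1)).enorm
      rw [hθ, sub_self, enorm_zero] at h3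
      simpa [Function.comp_def] using ((ENNReal.continuous_pow 2).tendsto 0).comp h3
    simpa using ENNReal.Tendsto.mul_const h2 (.inr (by finiteness))

/-- The maps `n⁻¹ • id` have norm at most one, so the remainders are bounded in `H^{2s}`; they tend
to zero in `L²`, and interpolation concludes. The extra regularity costs nothing for Schwartz
functions. -/
theorem tendsto_fourierNormSq_sub_dilated_cutoff {θ : 𝓢(E, ℂ)} (hθ : θ 0 = 1) {s : ℝ}
    (hs : 0 ≤ s) (u : Lp ℂ 2 (volume : Measure E))
    (hu : fourierNormSq (sobolevWeight (2 * s)) u ≠ ⊤) :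
    Tendsto (fun n : ℕ => fourierNormSq (sobolevWeight s)
      (u - mulL2 (pullback θ ((n : ℝ)⁻¹ • .id ℝ E)) u)) atTop (𝓝 0) := by
  obtain ⟨C, hC, h⟩ := exists_fourierNormSq_sobolevWeight_mulL2_le (E := E) θ
    (s := 2 * s) (by linarith) zero_le_one
  set N := fourierNormSq (sobolevWeight (2 * s)) u
  have hbd : ∀ n : ℕ, fourierNormSq (sobolevWeight (2 * s))
      (u - mulL2 (pullback θ ((n : ℝ)⁻¹ • .id ℝ E)) u) ≤ 2 * (N + C * N) := by
    intro n
    refine (fourierNormSq_sub_le (by fun_prop) _ _).trans ?_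
    gcongr
    refine h _ ?_ u
    rw [norm_smul, norm_inv, Real.norm_natCast]
    exact mul_le_one₀ (Nat.cast_inv_le_one n) (norm_nonneg _) ContinuousLinearMap.norm_id_le
  rw [ENNReal.tendsto_nhds_zero]
  intro ε hε
  have hKtop : 2 * (N + C * N) ≠ ⊤ := by finiteness
  obtain ⟨δ, hδ, hδε⟩ : ∃ δ : ℝ, 0 < δ ∧ ENNReal.ofReal δ * (2 * (N + C * N)) < ε := by
    have h0 : Tendsto (fun δ : ℝ => ENNReal.ofReal δ * (2 * (N + C * N))) (𝓝[>] 0) (𝓝 0) := by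
      have := ENNReal.Tendsto.mul_const (b := 2 * (N + C * N))
        (ENNReal.tendsto_ofReal (tendsto_id (x := 𝓝 (0 : ℝ)))) (.inr hKtop)
      simp only [id_eq, ENNReal.ofReal_zero, zero_mul] at this
      exact this.mono_left nhdsWithin_le_nhds
    obtain ⟨δ, h₁, h₂⟩ := ((h0.eventually (gt_mem_nhds hε)).and self_mem_nhdsWithin).exists
    exact ⟨δ, h₂, h₁⟩
  have hlim : Tendsto (fun n : ℕ => ENNReal.ofReal (1 + δ⁻¹) *
      (∫⁻ x, ‖(u - mulL2 (pullback θ ((n : ℝ)⁻¹ • .id ℝ E)) u :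
        Lp ℂ 2 (volume : Measure E)) x‖ₑ ^ 2) + ENNReal.ofReal δ * (2 * (N + C * N))) atTop
      (𝓝 (ENNReal.ofReal δ * (2 * (N + C * N)))) := by
    simpa using (ENNReal.Tendsto.const_mul (a := ENNReal.ofReal (1 + δ⁻¹))
      (tendsto_lintegral_sub_dilated_cutoff hθ u) (.inr (by finiteness))).add_const
        (ENNReal.ofReal δ * (2 * (N + C * N)))
  filter_upwards [hlim.eventually (gt_mem_nhds hδε)] with n hn
  refine (fourierNormSq_sobolevWeight_interpolation hδ _).trans (le_trans ?_ hn.le)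
  gcongr
  exact hbd n

end SobolevLimits

/-! ### Approximation by functions vanishing near the kernels -/

section HardCore

open SchwartzMap Filter Topology

variable {E Q : Type*} [NormedAddCommGroup E] [InnerProductSpace ℝ E] [FiniteDimensional ℝ E]
  [MeasurableSpace E] [BorelSpace E]
  [NormedAddCommGroup Q] [InnerProductSpace ℝ Q] [FiniteDimensional ℝ Q]
  [MeasurableSpace Q] [BorelSpace Q]

theorem two_mul_add_lt_of_lt_div_four {a b ε : ℝ≥0∞} (ha : a < ε / 4) (hb : b < ε / 4) :
    2 * (a + b) < ε := by
  calc 2 * (a + b) < 2 * (ε / 4 + ε / 4) :=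
        (ENNReal.mul_lt_mul_iff_right two_ne_zero ENNReal.ofNat_ne_top).2 (ENNReal.add_lt_add ha hb)
    _ = 4 * (ε / 4) := by ring
    _ = ε := ENNReal.mul_div_cancel (by norm_num) ENNReal.ofNat_ne_top

theorem fourierNormSq_sub_lt {w : E → ℝ≥0∞} (hw : Measurable w)
    {u v f : Lp ℂ 2 (volume : Measure E)} {ε : ℝ≥0∞} (h₁ : fourierNormSq w (u - v) < ε / 4)
    (h₂ : fourierNormSq w (v - f) < ε / 4) : fourierNormSq w (u - f) < ε := by
  rw [← sub_add_sub_cancel u v f]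
  exact (fourierNormSq_add_le hw _ _).trans_lt (two_mul_add_lt_of_lt_div_four h₁ h₂)

/-- A function in `H^s` with `|ℓ_p|^{-s} u ∈ L²` for finitely many linear maps `ℓ_p` is approximated
in `H^s` by functions vanishing near the kernels of the `ℓ_p`. -/
theorem exists_vanishing_near_ker {ι : Type*} (ℓ : ι → E →L[ℝ] Q) {s : ℝ} (hs : 0 < s)
    (u : Lp ℂ 2 (volume : Measure E)) (hu : fourierNormSq (sobolevWeight s) u ≠ ⊤)
    (P : Finset ι) (hI : ∀ p ∈ P, ∫⁻ x, ‖ℓ p x‖ₑ ^ (-(2 * s)) * ‖u x‖ₑ ^ 2 ≠ ⊤) {ε : ℝ≥0∞}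
    (hε : 0 < ε) :
    ∃ v : Lp ℂ 2 (volume : Measure E), fourierNormSq (sobolevWeight s) (u - v) < ε ∧
      fourierNormSq (sobolevWeight s) v ≠ ⊤ ∧
      (∃ C : ℝ≥0∞, C ≠ ⊤ ∧ ∀ᵐ x, ‖v x‖ₑ ≤ C * ‖u x‖ₑ) ∧
      ∃ r : ℝ, 0 < r ∧ ∀ᵐ x, (∃ p ∈ P, ‖ℓ p x‖ < r) → v x = 0 := by
  classical
  induction P using Finset.induction_on generalizing ε with
  | empty =>
    refine ⟨u, ?_, hu, ⟨1, ENNReal.one_ne_top, by simp⟩, 1, one_pos, by simp⟩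
    have h0 : (𝓕 (u - u) : Lp ℂ 2 (volume : Measure E)) = 0 := by
      rw [sub_self]
      exact (Lp.fourierTransformₗᵢ E ℂ).map_zero
    have : fourierNormSq (sobolevWeight s) (u - u) = 0 := by
      unfold fourierNormSq
      simp [h0]
    rwa [this]
  | insert p P hp ih =>
    have hε' : 0 < ε / 4 := ENNReal.div_pos hε.ne' (by norm_num)
    obtain ⟨v, huv, hv, ⟨C, hC, hvu⟩, r, hr, hvr⟩ :=
      ih (fun q hq => hI q (Finset.mem_insert_of_mem hq)) hε'
    obtain ⟨γ, κ, ρ, r₀, R, hr₀, hR, hρ, hγ, hκγ, hκ⟩ := exists_cutoff_factorization Q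
    -- The pointwise bound by `u` is carried through the induction so that earlier cutoffs keep the
    -- weighted integral for the next map finite.
    have hIv : ∫⁻ x, ‖ℓ p x‖ₑ ^ (-(2 * s)) * ‖v x‖ₑ ^ 2 ≠ ⊤ := by
      refine ne_top_of_le_ne_top (ENNReal.mul_ne_top (ENNReal.pow_ne_top hC (n := 2))
        (hI p (Finset.mem_insert_self p P))) ?_
      rw [← lintegral_const_mul' _ _ (by finiteness)]
      refine lintegral_mono_ae ?_
      filter_upwards [hvu] with x hx
      calc _ ≤ ‖ℓ p x‖ₑ ^ (-(2 * s)) * (C * ‖u x‖ₑ) ^ 2 := by gcongr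
        _ = _ := by ring
    obtain ⟨n, hn, hn1⟩ := (((tendsto_fourierNormSq_mulL2 κ hρ hγ (ℓ p) hs v hv hIv).eventually
      (gt_mem_nhds hε')).and (eventually_ge_atTop 1)).exists
    have hn0 : (0 : ℝ) < n := by exact_mod_cast hn1
    set z := mulL2 (pullback κ ((n : ℝ) • ℓ p)) (mulL2 (pullback γ ((n : ℝ) • ℓ p)) v) with hz
    have hz' : ∀ᵐ x, (v - z : Lp ℂ 2 (volume : Measure E)) x =
        (1 - κ ((n : ℝ) • ℓ p x) * γ ((n : ℝ) • ℓ p x)) * v x := by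
      filter_upwards [Lp.coeFn_sub v z, coeFn_mulL2 (pullback κ ((n : ℝ) • ℓ p))
        (mulL2 (pullback γ ((n : ℝ) • ℓ p)) v), coeFn_mulL2 (pullback γ ((n : ℝ) • ℓ p)) v]
        with x h₁ h₂ h₃
      rw [h₁, Pi.sub_apply, hz, h₂, h₃]
      simp only [pullback_apply, smul_apply]
      ring
    refine ⟨v - z, fourierNormSq_sub_lt (by fun_prop) huv (by rwa [sub_sub_cancel]), ?_,
      ⟨ENNReal.ofReal (1 + ‖κ.toBoundedContinuousFunction‖ * ‖γ.toBoundedContinuousFunction‖) * C,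
        by finiteness, ?_⟩, min r (r₀ / n), by positivity, ?_⟩
    · refine ne_top_of_le_ne_top ?_ (fourierNormSq_sub_le (by fun_prop) _ _)
      have := (hn.trans_le le_top).ne
      finiteness
    · filter_upwards [hz', hvu] with x h₁ h₂
      rw [h₁, enorm_mul, mul_assoc]
      gcongr
      rw [← ofReal_norm]
      refine ENNReal.ofReal_le_ofReal ((norm_sub_le _ _).trans ?_)
      rw [norm_one, norm_mul]
      gcongr
      · exact κ.toBoundedContinuousFunction.norm_coe_le_norm _
      · exact γ.toBoundedContinuousFunction.norm_coe_le_norm _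
    · filter_upwards [hz', hvr] with x h₁ h₂
      rintro ⟨q, hq, hqr⟩
      rw [h₁]
      rcases Finset.mem_insert.1 hq with rfl | hq
      · rw [hκγ, sub_self, zero_mul]
        rw [norm_smul, Real.norm_natCast, mul_comm, ← lt_div_iff₀ hn0]
        exact hqr.trans_le (min_le_right _ _)
      · rw [h₂ ⟨q, hq, hqr.trans_le (min_le_left _ _)⟩, mul_zero]

/-- A function in `H^s` vanishing near the kernels of finitely many linear maps is approximated in
`H^s` by Schwartz functions with the same property. -/
theorem exists_schwartz_vanishing_near_ker {ι : Type*} (ℓ : ι → E →L[ℝ] Q) {s : ℝ} (hs : 0 ≤ s)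
    (v : Lp ℂ 2 (volume : Measure E)) (hv : fourierNormSq (sobolevWeight s) v ≠ ⊤)
    (P : Finset ι) {r : ℝ} (hr : 0 < r) (hvr : ∀ᵐ x, (∃ p ∈ P, ‖ℓ p x‖ < r) → v x = 0)
    {ε : ℝ≥0∞} (hε : 0 < ε) :
    ∃ φ : 𝓢(E, ℂ), fourierNormSq (sobolevWeight s) (v - φ.toLp 2 volume) < ε ∧
      ∃ r' : ℝ, 0 < r' ∧ ∀ x, (∃ p ∈ P, ‖ℓ p x‖ < r') → φ x = 0 := by
  classical
  induction P using Finset.induction_on generalizing ε with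
  | empty =>
    obtain ⟨φ, hφ⟩ := exists_schwartz_fourierNormSq_sub_lt hs v hv hε
    exact ⟨φ, hφ, 1, one_pos, by simp⟩
  | insert p P hp ih =>
    obtain ⟨γ, κ, ρ, r₀, R, hr₀, hR, hρ, hγ, hκγ, hκ⟩ := exists_cutoff_factorization Q
    -- This dilation places the support of `κ ∘ ℓ'` inside `‖ℓ p x‖ < r`, where `v` vanishes, so
    -- multiplication by `1 - κγ` fixes `v`.
    set ℓ' := (R / r) • ℓ p with hℓ'
    have hℓ'x : ∀ x, ‖ℓ' x‖ = R / r * ‖ℓ p x‖ := fun x => by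
      rw [hℓ', smul_apply, norm_smul, Real.norm_of_nonneg (by positivity)]
    obtain ⟨C₁, hC₁, h₁⟩ :=
      exists_fourierNormSq_sobolevWeight_mulL2_le (E := E) κ hs (norm_nonneg ℓ')
    obtain ⟨C₂, hC₂, h₂⟩ :=
      exists_fourierNormSq_sobolevWeight_mulL2_le (E := E) γ hs (norm_nonneg ℓ')
    -- Since `v` is fixed, the cutoff acts only on the error, enlarging its squared norm by at most
    -- `2 (1 + C₁ C₂)`.
    have hδ : 0 < ε / (2 * (1 + C₁ * C₂)) := ENNReal.div_pos hε.ne' (by finiteness)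
    obtain ⟨φ, hφ, r', hr', hφr⟩ := ih (hvr.mono fun x hx ⟨q, hq, hqr⟩ =>
      hx ⟨q, Finset.mem_insert_of_mem hq, hqr⟩) hδ
    have tκ : (fun x => κ (ℓ' x)).HasTemperateGrowth :=
      κ.hasTemperateGrowth.comp ℓ'.hasTemperateGrowth
    have tγ : (fun x => γ (ℓ' x)).HasTemperateGrowth :=
      γ.hasTemperateGrowth.comp ℓ'.hasTemperateGrowth
    set φ' := φ - smulLeftCLM ℂ (fun x => κ (ℓ' x)) (smulLeftCLM ℂ (fun x => γ (ℓ' x)) φ) with hφ'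
    have hφ'x : ∀ x, φ' x = (1 - κ (ℓ' x) * γ (ℓ' x)) * φ x := fun x => by
      rw [hφ', sub_apply, smulLeftCLM_apply_apply tκ, smulLeftCLM_apply_apply tγ]
      simp only [smul_eq_mul]
      ring
    have hv0 : mulL2 (pullback κ ℓ') (mulL2 (pullback γ ℓ') v) = 0 := by
      refine Lp.ext ?_
      filter_upwards [coeFn_mulL2 (pullback κ ℓ') (mulL2 (pullback γ ℓ') v),
        coeFn_mulL2 (pullback γ ℓ') v, hvr, Lp.coeFn_zero ℂ 2 (volume : Measure E)]
        with x e₁ e₂ hx e₃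
      rw [e₁, e₂, e₃, Pi.zero_apply, pullback_apply]
      by_cases hxr : ‖ℓ p x‖ < r
      · rw [hx ⟨p, Finset.mem_insert_self p P, hxr⟩, mul_zero, mul_zero]
      · have : κ (ℓ' x) = 0 := by
          by_contra hne
          have := hκ _ hne
          rw [hℓ'x, div_mul_eq_mul_div, div_lt_iff₀ hr] at this
          exact hxr (lt_of_mul_lt_mul_left this hR.le)
        rw [this, zero_mul]
    have hsub : v - φ'.toLp 2 volume = (v - φ.toLp 2 volume) -
        mulL2 (pullback κ ℓ') (mulL2 (pullback γ ℓ') (v - φ.toLp 2 volume)) := by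
      have e : φ'.toLp 2 volume = φ.toLp 2 volume -
          mulL2 (pullback κ ℓ') (mulL2 (pullback γ ℓ') (φ.toLp 2 volume)) := by
        rw [mulL2_toLp, mulL2_toLp]
        exact (SchwartzMap.toLpCLM ℝ ℂ 2 (volume : Measure E)).map_sub _ _
      rw [e, map_sub, map_sub, hv0]
      abel
    refine ⟨φ', ?_, min r' (r₀ / (R / r)), by positivity, ?_⟩
    · rw [hsub]
      refine (fourierNormSq_sub_le (by fun_prop) _ _).trans_lt ?_
      set N := fourierNormSq (sobolevWeight s) (v - φ.toLp 2 volume)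
      calc _ ≤ 2 * (N + C₁ * (C₂ * N)) := by
            gcongr
            exact (h₁ ℓ' le_rfl _).trans (mul_le_mul_right (h₂ ℓ' le_rfl _) _)
        _ = 2 * (1 + C₁ * C₂) * N := by ring
        _ < ε := ENNReal.mul_lt_of_lt_div' hφ
    · rintro x ⟨q, hq, hqr⟩
      rw [hφ'x]
      rcases Finset.mem_insert.1 hq with rfl | hq
      · rw [hκγ, sub_self, zero_mul]
        rw [hℓ'x, mul_comm, ← lt_div_iff₀ (by positivity)]
        exact hqr.trans_le (min_le_right _ _)
      · rw [hφr x ⟨q, hq, hqr.trans_le (min_le_left _ _)⟩, mul_zero]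

/-- Schwartz functions are approximated in `H^s` by their products with smooth cutoffs at
infinity. -/
theorem exists_compactlySupported_fourierNormSq_sub_lt {s : ℝ} (hs : 0 ≤ s) (φ : 𝓢(E, ℂ))
    {ε : ℝ≥0∞} (hε : 0 < ε) :
    ∃ ψ : 𝓢(E, ℂ), HasCompactSupport ψ ∧ Function.support ψ ⊆ Function.support φ ∧
      fourierNormSq (sobolevWeight s) (φ.toLp 2 volume - ψ.toLp 2 volume) < ε := by
  let b : ContDiffBump (0 : E) := ⟨1, 2, one_pos, one_lt_two⟩
  have hb : HasCompactSupport fun q => (b q : ℂ) :=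
    b.hasCompactSupport.comp_left (g := Complex.ofReal) Complex.ofReal_zero
  let θ : 𝓢(E, ℂ) := hb.toSchwartzMap (Complex.ofRealCLM.contDiff.comp b.contDiff)
  have hθ : θ 0 = 1 := by
    change ((b 0 : ℝ) : ℂ) = 1
    rw [b.one_of_mem_closedBall (by simp [b]), Complex.ofReal_one]
  obtain ⟨n, hn, hn1⟩ := (((tendsto_fourierNormSq_sub_dilated_cutoff hθ hs (φ.toLp 2 volume)
    (fourierNormSq_sobolevWeight_toLp_ne_top (by linarith) φ)).eventually
      (gt_mem_nhds hε)).and (eventually_ge_atTop 1)).exists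
  have hn0 : (n : ℝ)⁻¹ ≠ 0 := inv_ne_zero (by exact_mod_cast (by omega : n ≠ 0))
  have tθ : (fun x => θ (((n : ℝ)⁻¹ • ContinuousLinearMap.id ℝ E) x)).HasTemperateGrowth :=
    θ.hasTemperateGrowth.comp (ContinuousLinearMap.hasTemperateGrowth _)
  have hψ : ⇑(smulLeftCLM ℂ (fun x => θ (((n : ℝ)⁻¹ • ContinuousLinearMap.id ℝ E) x)) φ) =
      fun x => θ ((n : ℝ)⁻¹ • x) * φ x := by
    ext x
    rw [smulLeftCLM_apply_apply tθ]
    rfl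
  refine ⟨smulLeftCLM ℂ (fun x => θ (((n : ℝ)⁻¹ • ContinuousLinearMap.id ℝ E) x)) φ,
    ?_, ?_, ?_⟩
  · rw [hψ]
    exact HasCompactSupport.mul_right (hb.comp_smul hn0)
  · rw [hψ]
    exact Function.support_mul_subset_right _ _
  · rwa [mulL2_toLp] at hn

end HardCore

/-! ### Application to the pair interaction -/

variable {d N : ℕ}

theorem sobolevNormSq_eq_fourierNormSq (s : ℝ) (u : L2 d N) :
    sobolevNormSq s u = fourierNormSq (sobolevWeight s) u := by
  unfold sobolevNormSq
  rw [← fourierNormSq_one]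
  refine (fourierNormSq_add (w₁ := fun _ => 1) measurable_const u).symm.trans ?_
  congr 1
  ext ξ
  unfold sobolevWeight
  rw [ENNReal.ofReal_add zero_le_one (by positivity), ENNReal.ofReal_one]

/-- The relative position of two particles. -/
noncomputable def relativePosition (p : Fin N × Fin N) : Config d N →L[ℝ] EuclideanSpace ℝ (Fin d) :=
  LinearMap.toContinuousLinearMap
    { toFun := fun x => position x p.1 - position x p.2
      map_add' := fun x y => by ext a; simp [position]; ring
      map_smul' := fun c x => by ext a; simp [position]; ring }

theorem relativePosition_apply (p : Fin N × Fin N) (x : Config d N) :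
    relativePosition p x = position x p.1 - position x p.2 := rfl

theorem enorm_relativePosition_rpow_le_pairInteraction {p : Fin N × Fin N} (hp : p.1 < p.2) (s : ℝ)
    (x : Config d N) : ‖relativePosition p x‖ₑ ^ (-(2 * s)) ≤ pairInteraction s x := by
  rw [relativePosition_apply, ← edist_eq_enorm_sub]
  unfold pairInteraction
  calc _ ≤ ∑ j ∈ Finset.Ioi p.1, edist (position x p.1) (position x j) ^ (-(2 * s)) :=
        Finset.single_le_sum
          (f := fun j => edist (position x p.1) (position x j) ^ (-(2 * s)))
          (fun _ _ => zero_le) (Finset.mem_Ioi.2 hp)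
    _ ≤ _ := Finset.single_le_sum
          (f := fun i => ∑ j ∈ Finset.Ioi i, edist (position x i) (position x j) ^ (-(2 * s)))
          (fun _ _ => zero_le) (Finset.mem_univ p.1)

end ContactInteraction

open ContactInteraction in
theorem interactionFormDomain_subset_hardCoreSpace (d N : ℕ) {s : ℝ} (hs : 0 < s) :
    interactionFormDomain d N s ⊆ hardCoreSpace d N s := by
  rintro Ψ ⟨hΨ, hW⟩
  refine ⟨hΨ, fun ε hε => ?_⟩
  have hε₁ : 0 < ε / 4 := ENNReal.div_pos hε.ne' (by norm_num)
  -- Each use of the squared triangle inequality costs a factor of four; the last two approximations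
  -- pass through it twice.
  have hε₂ : 0 < ε / 4 / 4 := ENNReal.div_pos hε₁.ne' (by norm_num)
  have hΨ' : fourierNormSq (sobolevWeight s) Ψ ≠ ⊤ := by
    rw [← sobolevNormSq_eq_fourierNormSq]
    exact ne_of_lt hΨ
  let P : Finset (Fin N × Fin N) := Finset.univ.filter fun p => p.1 < p.2
  obtain ⟨v, hv₁, hv₂, -, r, hr, hvr⟩ := exists_vanishing_near_ker
    (relativePosition (d := d) (N := N)) hs Ψ hΨ' P (fun p hp => by
      refine ne_top_of_le_ne_top hW.ne (lintegral_mono fun x => ?_)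
      gcongr
      exact enorm_relativePosition_rpow_le_pairInteraction (Finset.mem_filter.1 hp).2 s x) hε₁
  obtain ⟨φ, hφ, r', hr', hφr⟩ := exists_schwartz_vanishing_near_ker _ hs.le v hv₂ P hr hvr hε₂
  obtain ⟨ψ, hψ₁, hψ₂, hψ₃⟩ := exists_compactlySupported_fourierNormSq_sub_lt hs.le φ hε₂
  refine ⟨ψ.toLp 2 volume, ⟨ψ, ψ.smooth ⊤, hψ₁, ?_, ψ.coeFn_toLp 2 volume⟩, ?_⟩
  · have hclosed : IsClosed {x : Config d N | ∀ p ∈ P, r' ≤ ‖relativePosition p x‖} := by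
      simp only [Set.ofPred_forall]
      exact isClosed_biInter fun p _ =>
        isClosed_le continuous_const (relativePosition p).continuous.norm
    refine (closure_minimal (fun x hx p hp => ?_) hclosed).trans ?_
    · by_contra! hlt
      exact hψ₂ hx (hφr x ⟨p, hp, hlt⟩)
    · rintro x hx ⟨i, j, hij, hpos⟩
      rcases lt_or_gt_of_ne hij with h | h
      · have := hx (i, j) (Finset.mem_filter.2 ⟨Finset.mem_univ _, h⟩)
        rw [relativePosition_apply, hpos, sub_self, norm_zero] at this
        linarith
      · have := hx (j, i) (Finset.mem_filter.2 ⟨Finset.mem_univ _, h⟩)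
        rw [relativePosition_apply, hpos, sub_self, norm_zero] at this
        linarith
  · rw [sobolevNormSq_eq_fourierNormSq]
    exact fourierNormSq_sub_lt (by fun_prop) hv₁ (fourierNormSq_sub_lt (by fun_prop) hφ hψ₃)

theorem lemmaB2 (d N : ℕ) (hd : 1 ≤ d) (hN : 2 ≤ N) (s : ℝ) (hs : 0 < s) :
    ContactInteraction.interactionFormDomain d N s ⊆ ContactInteraction.hardCoreSpace d N s :=
  interactionFormDomain_subset_hardCoreSpace d N hs
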